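/- For a finite connected simple graph $G$ with at least one edge, let $\kappa(G)=\sum_{j} m_{ij}\,\pi(j)$ be Kemeny's constant of the simple random walk on $G$. Here $m_{ij}$ is the mean first passage time from $i$ to $j$ (so $m_{jj}=0$) and $\pi(j)=\deg_G(j)/(2|E(G)|)$ is the stationary distribution; the sum does not depend on the vertex $i$. Let $\tau_G$ be the number of spanning trees of $G$. For vertices $x,v$, let $f^G_{x,v}$ be the number of spanning forests of $G$ that consist of exactly two trees, one containing $x$ and the other containing $v$. The moment of $v$ is $\mu(G,v)=\frac1{\tau_G}\sum_{x}\deg_G(x)\,f^G_{x,v}$. For distinct nonadjacent vertices $i,j$ of $G$, let $G^{\{i,j\}}$ be $G$ with the edge $\{i,j\}$ added; the pair $\{i,j\}$ is a Braess edge of $G$ if $\kappa(G^{\{i,j\}})>\kappa(G)$. Let $a\ge 2$, let $\mathcal P_{2a+1}=(1,2,\dots,2a+1)$ be the path on $2a+1$ vertices, let $v=a+1$ be its center vertex, and let $1\le i<j\le 2a+1$ with $j-i\ge 2$. 1. If $\kappa(\mathcal P_{2a+1}^{\{i,j\}})-\kappa(\mathcal P_{2a+1})>0$, then $$\mu(\mathcal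 P_{2a+1}^{\{i,j\}},v)-\kappa(\mathcal P_{2a+1}^{\{i,j\}})-\frac23a^2+\frac16>0 .$$ 2. For $b\ge 2$, let $\mathcal S_{a,b}$ be the spider graph consisting of $b$ paths of length $a$ that share one common end-vertex (the center) and are otherwise disjoint. Choose two distinct pendent vertices of $\mathcal S_{a,b}$ and identify $\mathcal P_{2a+1}$ with the path in $\mathcal S_{a,b}$ from one to the other. If $\{i,j\}$ is a Braess edge of $\mathcal P_{2a+1}$, then $\{i,j\}$ is also a Braess edge of $\mathcal S_{a,b}$. -/

import Mathlib

open scoped ENNReal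

namespace SimpleGraph

open Classical in
/-- One-step transition probability of the simple random walk on `G`: from `x` the walker moves to
a uniformly chosen neighbour of `x`. -/
noncomputable def stepProb {V : Type*} [Fintype V] (G : SimpleGraph V) (x y : V) : ℝ≥0∞ :=
  if G.Adj x y then (G.degree x : ℝ≥0∞)⁻¹ else 0

/-- Probability that the random walk started at `x 0` follows the trajectory
`x 0, x 1, …, x t` during its first `t` steps. -/
noncomputable def trajProb {V : Type*} [Fintype V] (G : SimpleGraph V) {t : ℕ}
    (x : Fin (t + 1) → V) : ℝ≥0∞ :=
  ∏ s : Fin t, G.stepProb (x s.castSucc) (x s.succ)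

open Classical in
/-- `G.survivalProb i j t` is the probability that the random walk started at `i` does not visit
`j` at any of the times `0, 1, …, t`; that is, the probability of `{T > t}`, where `T` is the first
time (possibly `0`) at which the walk is at `j`. -/
noncomputable def survivalProb {V : Type*} [Fintype V] (G : SimpleGraph V) (i j : V) (t : ℕ) :
    ℝ≥0∞ :=
  ∑ x : Fin (t + 1) → V with x 0 = i ∧ ∀ s, x s ≠ j, G.trajProb x

/-- Mean first passage time `m_{ij}`: the expectation of the first time `T` at which the random
walk started at `i` is at `j`, written as the sum over `t` of the probabilities of `{T > t}`.
In particular `m_{jj} = 0`. -/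
noncomputable def meanFirstPassage {V : Type*} [Fintype V] (G : SimpleGraph V) (i j : V) : ℝ≥0∞ :=
  ∑' t : ℕ, G.survivalProb i j t

open Classical in
/-- Stationary distribution of the random walk: `π(x) = deg(x) / (2 |E|)`. -/
noncomputable def stationaryProb {V : Type*} [Fintype V] (G : SimpleGraph V) (x : V) : ℝ :=
  (G.degree x : ℝ) / (2 * (G.edgeFinset.card : ℝ))

/-- The distribution `π` is invariant under one step of the random walk. -/
theorem sum_stationaryProb_mul_stepProb {V : Type*} [Fintype V] (G : SimpleGraph V) (y : V) :
    ∑ x, G.stationaryProb x * (G.stepProb x y).toReal = G.stationaryProb y := by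
  classical
  have key : ∀ x, G.stationaryProb x * (G.stepProb x y).toReal =
      if x ∈ G.neighborFinset y then 1 / (2 * (G.edgeFinset.card : ℝ)) else 0 := by
    intro x
    unfold stationaryProb stepProb
    simp only [mem_neighborFinset, G.adj_comm y x]
    split_ifs with hx
    · have hd : (G.degree x : ℝ) ≠ 0 := by
        exact_mod_cast ((G.degree_pos_iff_exists_adj x).mpr ⟨y, hx⟩).ne'
      rw [ENNReal.toReal_inv, ENNReal.toReal_natCast, div_mul_eq_mul_div, mul_inv_cancel₀ hd]
    · simp
  rw [Finset.sum_congr rfl fun x _ => key x, Finset.sum_ite_mem, Finset.univ_inter,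
    Finset.sum_const, card_neighborFinset_eq_degree, nsmul_eq_mul, mul_one_div]
  rfl

/-- `∑ⱼ m_{ij} π(j)`, computed from the starting vertex `i`. -/
noncomputable def kemenyFrom {V : Type*} [Fintype V] (G : SimpleGraph V) (i : V) : ℝ :=
  ∑ j, (G.meanFirstPassage i j).toReal * G.stationaryProb j

/-- Kemeny's constant `κ(G) = ∑ⱼ m_{ij} π(j)` of a connected graph. The choice of the starting
vertex `i` is immaterial, see `SimpleGraph.Connected.kemenyFrom_eq_kemeny`. -/
noncomputable def kemeny {V : Type*} [Fintype V] [Nonempty V] (G : SimpleGraph V) : ℝ :=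
  G.kemenyFrom (Classical.arbitrary V)

/-! The starting vertex in Kemeny's constant is immaterial. -/

open Classical in
theorem survivalProb_zero {V : Type*} [Fintype V] (G : SimpleGraph V) (i j : V) :
    G.survivalProb i j 0 = if i = j then 0 else 1 := by
  unfold survivalProb trajProb
  simp only [Finset.univ_eq_empty, Finset.prod_empty, Finset.sum_const, nsmul_eq_mul, mul_one]
  split_ifs with h
  · subst h
    rw [Nat.cast_eq_zero, Finset.card_eq_zero, Finset.filter_eq_empty_iff]
    rintro x - ⟨h1, h2⟩
    exact h2 0 h1
  · rw [Nat.cast_eq_one, Finset.card_eq_one]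
    refine ⟨fun _ => i, ?_⟩
    ext x
    simp only [Finset.mem_filter, Finset.mem_univ, true_and, Finset.mem_singleton]
    constructor
    · rintro ⟨h1, -⟩
      funext s
      rw [show s = 0 from Fin.ext (by omega), h1]
    · rintro rfl
      exact ⟨rfl, fun _ => h⟩

theorem survivalProb_self {V : Type*} [Fintype V] (G : SimpleGraph V) (j : V) (t : ℕ) :
    G.survivalProb j j t = 0 := by
  unfold survivalProb
  refine Finset.sum_eq_zero fun x hx => ?_
  simp only [Finset.mem_filter, Finset.mem_univ, true_and] at hx
  exact absurd hx.1 (hx.2 0)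

theorem survivalProb_succ {V : Type*} [Fintype V] (G : SimpleGraph V) {i j : V} (hij : i ≠ j)
    (t : ℕ) :
    G.survivalProb i j (t + 1) = ∑ k, G.stepProb i k * G.survivalProb k j t := by
  classical
  have key : ∀ k, G.stepProb i k * G.survivalProb k j t =
      ∑ y : Fin (t + 1) → V, if y 0 = k ∧ ∀ s, y s ≠ j then
        G.stepProb i (y 0) * G.trajProb y else 0 := by
    intro k
    unfold survivalProb
    rw [Finset.sum_filter, Finset.mul_sum]
    refine Finset.sum_congr rfl fun y _ => ?_
    by_cases h : y 0 = k ∧ ∀ s, y s ≠ j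
    · rw [if_pos h, if_pos h, h.1]
    · rw [if_neg h, if_neg h, mul_zero]
  rw [Finset.sum_congr rfl fun k _ => key k, Finset.sum_comm]
  unfold survivalProb
  rw [Finset.sum_filter, ← (Fin.consEquiv fun _ : Fin (t + 2) => V).sum_comp,
    Fintype.sum_prod_type, Finset.sum_comm]
  refine Finset.sum_congr rfl fun y _ => ?_
  have e : ∀ x : V, (Fin.consEquiv fun _ : Fin (t + 2) => V) (x, y) = Fin.cons x y :=
    fun _ => rfl
  have e2 : ∀ x : V, G.trajProb (Fin.cons x y : Fin (t + 2) → V) =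
      G.stepProb x (y 0) * G.trajProb y := by
    intro x
    unfold trajProb
    rw [Fin.prod_univ_succ]
    congr 1
  simp only [e, Fin.cons_zero, Fin.forall_fin_succ (n := t + 1), Fin.cons_succ, e2]
  by_cases h : ∀ s, y s ≠ j
  · rw [Finset.sum_eq_single i, Finset.sum_eq_single (y 0)]
    · rw [if_pos ⟨rfl, hij, h⟩, if_pos ⟨rfl, h⟩]
    · intro k _ hk
      rw [if_neg]
      exact fun H => hk H.1.symm
    · simp
    · intro k _ hk
      rw [if_neg]
      exact fun H => hk H.1
    · simp
  · rw [Finset.sum_eq_zero, Finset.sum_eq_zero]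
    · intro k _
      rw [if_neg]
      exact fun H => h H.2
    · intro k _
      rw [if_neg]
      exact fun H => h H.2.2

theorem meanFirstPassage_self {V : Type*} [Fintype V] (G : SimpleGraph V) (j : V) :
    G.meanFirstPassage j j = 0 := by
  simp [meanFirstPassage, survivalProb_self]

theorem meanFirstPassage_of_ne {V : Type*} [Fintype V] (G : SimpleGraph V) {i j : V}
    (hij : i ≠ j) :
    G.meanFirstPassage i j = 1 + ∑ k, G.stepProb i k * G.meanFirstPassage k j := by
  unfold meanFirstPassage
  rw [tsum_eq_zero_add' (f := fun t => G.survivalProb i j t) ENNReal.summable,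
    survivalProb_zero, if_neg hij]
  congr 1
  simp_rw [G.survivalProb_succ hij, ← ENNReal.tsum_mul_left]
  rw [Summable.tsum_finsetSum fun _ _ => ENNReal.summable]

open Classical in
theorem sum_stepProb_mul {V : Type*} [Fintype V] (G : SimpleGraph V) (i : V) (f : V → ℝ≥0∞) :
    ∑ k, G.stepProb i k * f k = (G.degree i : ℝ≥0∞)⁻¹ * ∑ k ∈ G.neighborFinset i, f k := by
  rw [Finset.mul_sum, neighborFinset_eq_filter, Finset.sum_filter]
  refine Finset.sum_congr rfl fun k _ => ?_
  unfold stepProb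
  split_ifs <;> simp

open Classical in
/-- On a connected graph the hitting-time equations have a nonnegative solution. -/
theorem Connected.exists_hitting_solution {V : Type*} [Fintype V] [Nontrivial V]
    {G : SimpleGraph V} (hG : G.Connected) (j : V) :
    ∃ h : V → ℝ, (∀ i, 0 ≤ h i) ∧ h j = 0 ∧
      ∀ i, i ≠ j → (G.degree i : ℝ) * h i = G.degree i + ∑ k ∈ G.neighborFinset i, h k := by
  have hdeg : ∀ i, 0 < (G.degree i : ℝ) := fun i => by
    exact_mod_cast hG.preconnected.degree_pos_of_nontrivial i
  let T : (V → ℝ) →ₗ[ℝ] (V → ℝ) :=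
    { toFun := fun h i => if i = j then h j else (G.lapMatrix ℝ).mulVec h i
      map_add' := by
        intro x y; funext i; simp only [Matrix.mulVec_add, Pi.add_apply]; split_ifs <;> rfl
      map_smul' := by
        intro c y; funext i
        simp only [Matrix.mulVec_smul, Pi.smul_apply, RingHom.id_apply]; split_ifs <;> rfl }
  have hT : ∀ h i, T h i = if i = j then h j else (G.lapMatrix ℝ).mulVec h i := fun _ _ => rfl
  have hinj : Function.Injective T := by
    rw [← LinearMap.ker_eq_bot, LinearMap.ker_eq_bot']
    intro h hh
    have h0 : h j = 0 := by
      have := congrFun hh j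
      rwa [hT, if_pos rfl] at this
    have hq : Matrix.toLinearMap₂' ℝ (G.lapMatrix ℝ) h h = 0 := by
      rw [Matrix.toLinearMap₂'_apply']
      refine Finset.sum_eq_zero fun i _ => ?_
      by_cases hi : i = j
      · rw [hi, h0, zero_mul]
      · have := congrFun hh i
        rw [hT, if_neg hi] at this
        rw [this]; simp
    rw [lapMatrix_toLinearMap₂'_apply'_eq_zero_iff_forall_reachable] at hq
    funext i
    rw [hq i j (hG.preconnected i j), h0]; rfl
  obtain ⟨h, hh⟩ := (LinearMap.injective_iff_surjective.mp hinj)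
    (fun i => if i = j then 0 else (G.degree i : ℝ))
  have h0 : h j = 0 := by
    have := congrFun hh j
    simpa [hT] using this
  have hrec : ∀ i, i ≠ j →
      (G.degree i : ℝ) * h i = G.degree i + ∑ k ∈ G.neighborFinset i, h k := by
    intro i hi
    have := congrFun hh i
    rw [hT, if_neg hi, if_neg hi, lapMatrix_mulVec_apply] at this
    linarith
  refine ⟨h, ?_, h0, hrec⟩
  obtain ⟨x, -, hx⟩ := Finset.exists_min_image Finset.univ h ⟨j, Finset.mem_univ j⟩
  have hx0 : 0 ≤ h x := by
    by_cases hxj : x = j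
    · rw [hxj, h0]
    · exfalso
      have h1 := hrec x hxj
      have h2 : (G.degree x : ℝ) * h x ≤ ∑ k ∈ G.neighborFinset x, h k := by
        rw [← card_neighborFinset_eq_degree, ← nsmul_eq_mul]
        exact Finset.card_nsmul_le_sum _ _ _ fun k _ => hx k (Finset.mem_univ k)
      linarith [hdeg x]
  exact fun i => hx0.trans (hx i (Finset.mem_univ i))

theorem Connected.meanFirstPassage_ne_top {V : Type*} [Fintype V] {G : SimpleGraph V}
    (hG : G.Connected) (i j : V) : G.meanFirstPassage i j ≠ ⊤ := by
  classical
  rcases subsingleton_or_nontrivial V with hV | hV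
  · rw [Subsingleton.elim i j, meanFirstPassage_self]
    exact ENNReal.zero_ne_top
  obtain ⟨h, hpos, h0, hrec⟩ := hG.exists_hitting_solution j
  have hbound : ∀ n i, ∑ t ∈ Finset.range n, G.survivalProb i j t ≤ ENNReal.ofReal (h i) := by
    intro n
    induction n with
    | zero => intro i; simp
    | succ n ih =>
      intro i
      by_cases hi : i = j
      · subst hi; simp [survivalProb_self]
      have hd : 0 < (G.degree i : ℝ) := by
        exact_mod_cast hG.preconnected.degree_pos_of_nontrivial i
      have hi' : h i = 1 + (G.degree i : ℝ)⁻¹ * ∑ k ∈ G.neighborFinset i, h k := by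
        have := hrec i hi
        field_simp
        linarith
      rw [Finset.sum_range_succ', survivalProb_zero, if_neg hi]
      simp_rw [G.survivalProb_succ hi]
      rw [Finset.sum_comm]
      simp_rw [← Finset.mul_sum]
      rw [sum_stepProb_mul, hi', ENNReal.ofReal_add zero_le_one
        (mul_nonneg (inv_nonneg.mpr hd.le) (Finset.sum_nonneg fun k _ => hpos k)),
        ENNReal.ofReal_mul (inv_nonneg.mpr hd.le), ENNReal.ofReal_inv_of_pos hd,
        ENNReal.ofReal_sum_of_nonneg fun k _ => hpos k, ENNReal.ofReal_one, add_comm,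
        ENNReal.ofReal_natCast]
      gcongr with k _
      exact ih k
  have : G.meanFirstPassage i j ≤ ENNReal.ofReal (h i) := by
    unfold meanFirstPassage
    rw [ENNReal.tsum_eq_iSup_nat]
    exact iSup_le fun n => hbound n i
  exact ne_top_of_le_ne_top ENNReal.ofReal_ne_top this

open Classical in
/-- First-step equations for the mean first passage times. -/
theorem Connected.toReal_meanFirstPassage {V : Type*} [Fintype V] [Nontrivial V]
    {G : SimpleGraph V} (hG : G.Connected) {i j : V} (hij : i ≠ j) :
    (G.degree i : ℝ) * (G.meanFirstPassage i j).toReal =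
      G.degree i + ∑ k ∈ G.neighborFinset i, (G.meanFirstPassage k j).toReal := by
  have hd : (G.degree i : ℝ) ≠ 0 := by
    exact_mod_cast (hG.preconnected.degree_pos_of_nontrivial i).ne'
  have hd' : (G.degree i : ℝ≥0∞)⁻¹ ≠ ⊤ := by
    rw [ENNReal.inv_ne_top]
    exact_mod_cast (hG.preconnected.degree_pos_of_nontrivial i).ne'
  have hs : ∑ k ∈ G.neighborFinset i, G.meanFirstPassage k j ≠ ⊤ :=
    ENNReal.sum_ne_top.mpr fun k _ => hG.meanFirstPassage_ne_top k j
  rw [G.meanFirstPassage_of_ne hij, sum_stepProb_mul,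
    ENNReal.toReal_add ENNReal.one_ne_top (ENNReal.mul_ne_top hd' hs), ENNReal.toReal_mul,
    ENNReal.toReal_inv, ENNReal.toReal_natCast, ENNReal.toReal_one,
    ENNReal.toReal_sum fun k _ => hG.meanFirstPassage_ne_top k j]
  field_simp

/-- `∑ⱼ m_{ij} π(j)` does not depend on `i`. -/
theorem Connected.kemenyFrom_eq {V : Type*} [Fintype V] {G : SimpleGraph V}
    (hG : G.Connected) (i i' : V) : G.kemenyFrom i = G.kemenyFrom i' := by
  classical
  rcases subsingleton_or_nontrivial V with hV | hV
  · rw [Subsingleton.elim i i']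
  set h : V → V → ℝ := fun x j => (G.meanFirstPassage x j).toReal with hh
  have hself : ∀ j, h j j = 0 := fun j => by simp [hh, meanFirstPassage_self]
  have hrec : ∀ x j, x ≠ j →
      (G.degree x : ℝ) * h x j = G.degree x + ∑ k ∈ G.neighborFinset x, h k j :=
    fun x j hxj => hG.toReal_meanFirstPassage hxj
  have hswap : ∀ f : V → ℝ, ∑ x, ∑ k ∈ G.neighborFinset x, f k = ∑ k, (G.degree k : ℝ) * f k := by
    intro f
    simp_rw [neighborFinset_eq_filter, Finset.sum_filter]
    rw [Finset.sum_comm]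
    refine Finset.sum_congr rfl fun k _ => ?_
    rw [← Finset.sum_filter, Finset.sum_const, nsmul_eq_mul, ← card_neighborFinset_eq_degree,
      neighborFinset_eq_filter]
    simp_rw [G.adj_comm]
  -- the total degree
  have hD : ∑ x, (G.degree x : ℝ) = 2 * (G.edgeFinset.card : ℝ) := by
    exact_mod_cast G.sum_degrees_eq_twice_card_edges
  have hDpos : 0 < 2 * (G.edgeFinset.card : ℝ) := by
    rw [← hD]
    exact Finset.sum_pos (fun x _ => by
      exact_mod_cast hG.preconnected.degree_pos_of_nontrivial x) ⟨i, Finset.mem_univ i⟩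
  -- the expected return time
  have hret : ∀ j, (G.degree j : ℝ) + ∑ k ∈ G.neighborFinset j, h k j =
      2 * (G.edgeFinset.card : ℝ) := by
    intro j
    have h1 : ∑ x, ((G.degree x : ℝ) + ∑ k ∈ G.neighborFinset x, h k j - G.degree x * h x j) =
        (G.degree j : ℝ) + ∑ k ∈ G.neighborFinset j, h k j := by
      rw [Finset.sum_eq_single j]
      · rw [hself, mul_zero, sub_zero]
      · intro x _ hx
        rw [hrec x j hx, sub_self]
      · simp
    rw [← h1, Finset.sum_sub_distrib, Finset.sum_add_distrib, hswap fun k => h k j, hD]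
    ring
  have hlap : (G.lapMatrix ℝ).mulVec (fun x => G.kemenyFrom x) = 0 := by
    funext x
    rw [lapMatrix_mulVec_apply]
    have h2 : ∀ j, (G.degree x : ℝ) * (h x j * G.stationaryProb j) -
        ∑ k ∈ G.neighborFinset x, h k j * G.stationaryProb j =
        (G.degree x - if x = j then 2 * (G.edgeFinset.card : ℝ) else 0) * G.stationaryProb j := by
      intro j
      rw [← Finset.sum_mul]
      by_cases hx : x = j
      · subst hx
        have := hret x
        rw [hself, if_pos rfl, ← this]
        ring
      · rw [if_neg hx, ← mul_assoc, hrec x j hx]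
        ring
    have hsum : ∑ j, G.stationaryProb j = 1 := by
      unfold stationaryProb
      rw [← Finset.sum_div, hD, div_self hDpos.ne']
    change (G.degree x : ℝ) * ∑ j, h x j * G.stationaryProb j -
      ∑ k ∈ G.neighborFinset x, ∑ j, h k j * G.stationaryProb j = 0
    rw [Finset.sum_comm, Finset.mul_sum, ← Finset.sum_sub_distrib, Finset.sum_congr rfl
      fun j _ => h2 j]
    simp_rw [sub_mul, ite_mul, zero_mul]
    rw [Finset.sum_sub_distrib, ← Finset.mul_sum, hsum, Finset.sum_ite_eq]
    simp only [Finset.mem_univ, if_true]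
    unfold stationaryProb
    rw [mul_div_cancel₀ _ hDpos.ne', mul_one, sub_self]
  exact (G.lapMatrix_mulVec_eq_zero_iff_forall_reachable.mp hlap) i i' (hG.preconnected i i')

theorem Connected.kemenyFrom_eq_kemeny {V : Type*} [Fintype V] [Nonempty V] {G : SimpleGraph V}
    (hG : G.Connected) (i : V) : G.kemenyFrom i = G.kemeny :=
  hG.kemenyFrom_eq i _

/-- A pair of distinct nonadjacent vertices is a Braess edge if inserting the edge between them
increases Kemeny's constant. -/
def IsBraessEdge {V : Type*} [Fintype V] [Nonempty V] (G : SimpleGraph V) (u v : V) : Prop :=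
  u ≠ v ∧ ¬ G.Adj u v ∧ G.kemeny < (G ⊔ edge u v).kemeny

/-- Number of spanning trees. -/
noncomputable def numSpanningTrees {V : Type*} (G : SimpleGraph V) : ℕ :=
  {T : SimpleGraph V | T ≤ G ∧ T.IsTree}.ncard

/-- `f_{i,j}`: the number of spanning forests of `G` consisting of exactly two trees, one of which
contains `i` and the other `j`. -/
noncomputable def numTwoForests {V : Type*} (G : SimpleGraph V) (i j : V) : ℕ :=
  {H : SimpleGraph V | H ≤ G ∧ H.IsAcyclic ∧ Nat.card H.ConnectedComponent = 2 ∧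
    ¬ H.Reachable i j}.ncard

open Classical in
/-- Moment of a vertex: `μ(G, v) = (1 / τ) dᵀ F e_v`. -/
noncomputable def moment {V : Type*} [Fintype V] (G : SimpleGraph V) (v : V) : ℝ :=
  (1 / (G.numSpanningTrees : ℝ)) * ∑ x, (G.degree x : ℝ) * (G.numTwoForests x v : ℝ)

/-- The spider graph `S_{a,b}`. The vertex `none` is the center; `some (c, k)` is the vertex at
distance `k + 1` from the center on the `c`-th of the `b` legs, each of which has `a` vertices. -/
def spider (a b : ℕ) : SimpleGraph (Option (Fin b × Fin a)) :=
  fromRel fun x y =>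
    match x, y with
    | none, some (_, k) => (k : ℕ) = 0
    | some (c, k), some (c', k') => c = c' ∧ (k : ℕ) + 1 = (k' : ℕ)
    | _, _ => False

/-- The path with `2a + 1` vertices in `S_{a,b}` which runs from the pendent vertex of the leg `c`
through the center (its vertex with index `a`) to the pendent vertex of the leg `c'`. -/
def spiderPath {a b : ℕ} (c c' : Fin b) (x : Fin (2 * a + 1)) : Option (Fin b × Fin a) :=
  if h : (x : ℕ) < a then some (c, ⟨a - 1 - x, by omega⟩)
  else if h' : (x : ℕ) = a then none
  else some (c', ⟨x - a - 1, by omega⟩)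

/-- The path above is an induced path of the spider. -/
theorem spiderPath_injective {a b : ℕ} {c c' : Fin b} (hc : c ≠ c') :
    Function.Injective (spiderPath (a := a) c c') := by
  intro x y h
  unfold spiderPath at h
  ext
  split_ifs at h <;> simp_all <;> omega

theorem spider_adj_spiderPath {a b : ℕ} {c c' : Fin b} (hc : c ≠ c') (x y : Fin (2 * a + 1)) :
    (spider a b).Adj (spiderPath c c' x) (spiderPath c c' y) ↔ (pathGraph (2 * a + 1)).Adj x y := by
  have hne : spiderPath c c' x ≠ spiderPath c c' y ↔ x ≠ y := (spiderPath_injective hc).ne_iff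
  rw [spider, fromRel_adj, hne, pathGraph_adj]
  have hxy : x ≠ y ↔ (x : ℕ) ≠ (y : ℕ) := by rw [Ne, Fin.ext_iff]
  rw [hxy]
  unfold spiderPath
  split_ifs <;> simp [hc, hc.symm] <;> omega

end SimpleGraph

/-! Fix the center v and let H be the expected hitting time of v. Everything is expressed through
the Green function u_x of the Laplacian grounded at v, which is unique by
`Connected.isPotential_unique`. Counting forests against spanning trees shows that f_{x,v} / τ is
the diagonal value u_x(x) (`Connected.isPotential_numForestsSeparating`). Since m_{vx} = 2|E| u_x(x)
- H(x), this gives `Connected.kemeny_eq`: κ(G) = μ(G,v) - h(G), where h(G) is the degree-weighted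
mean of H, i.e. the mean hitting time of v from stationarity.

For a spider, h equals κ₀ = 2a²/3 - 1/6 whatever the number of legs, and the path is the case of two
legs. Assertion 1 therefore says that a Braess edge of the path also raises h above κ₀. Both the
gain M of the moment (`momentGain`) and the new h (`hittingSum` divided by 4a+2) have closed forms,
because adding an edge is a rank-one change of the Green function. `braess_inequality` proves the
claim: an edge with the center strictly between its ends is never Braess, and for an edge on one
side a suitable multiplier combines the Braess inequality with a polynomial that has no negative
coefficients.

For assertion 2, glue the remaining legs to the path at v. Moments add, and so do the weighted sums
of hitting times (`IsOneSum.kemeny_eq`); only the edge count in the denominator couples the two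
parts. The new edge thus changes Kemeny's constant of the spider by M minus the same excess of the
hitting sum, divided by a larger total degree. The excess is positive by assertion 1, so the gain is
at least that of the path. -/

namespace SimpleGraph

/-! ### The Dirichlet problem for the graph Laplacian -/

open Classical in
/-- `u` vanishes at `v` and its Laplacian is `f` at all other vertices. -/
def IsPotential {V : Type*} [Fintype V] (G : SimpleGraph V) (v : V) (f u : V → ℝ) : Prop :=
  u v = 0 ∧ ∀ y, y ≠ v → ∑ z ∈ G.neighborFinset y, (u y - u z) = f y

open Classical in
theorem sum_neighborFinset_sub {V : Type*} [Fintype V] (G : SimpleGraph V) (u : V → ℝ) (y : V) :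
    ∑ z ∈ G.neighborFinset y, (u y - u z) = G.degree y * u y - ∑ z ∈ G.neighborFinset y, u z := by
  rw [Finset.sum_sub_distrib, Finset.sum_const, nsmul_eq_mul, card_neighborFinset_eq_degree]

/-- The difference of two solutions vanishes at `v` and is harmonic elsewhere, so its Dirichlet
energy is zero. It is then constant on the connected graph, hence zero. -/
theorem Connected.isPotential_unique {V : Type*} [Fintype V] {G : SimpleGraph V}
    (hG : G.Connected) {v : V} {f u u' : V → ℝ} (hu : G.IsPotential v f u)
    (hu' : G.IsPotential v f u') : u = u' := by
  classical
  have hq : Matrix.toLinearMap₂' ℝ (G.lapMatrix ℝ) (u - u') (u - u') = 0 := by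
    rw [Matrix.toLinearMap₂'_apply']
    refine Finset.sum_eq_zero fun y _ => ?_
    by_cases hy : y = v
    · subst hy
      simp [hu.1, hu'.1]
    · have h1 := hu.2 y hy
      have h2 := hu'.2 y hy
      rw [sum_neighborFinset_sub] at h1 h2
      rw [lapMatrix_mulVec_apply]
      simp only [Pi.sub_apply, Finset.sum_sub_distrib]
      have : (G.degree y : ℝ) * (u y - u' y) -
          (∑ z ∈ G.neighborFinset y, u z - ∑ z ∈ G.neighborFinset y, u' z) = 0 := by
        linarith
      rw [this, mul_zero]
  rw [lapMatrix_toLinearMap₂'_apply'_eq_zero_iff_forall_reachable] at hq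
  funext y
  have := hq y v (hG.preconnected y v)
  simp only [Pi.sub_apply, hu.1, hu'.1] at this
  linarith

theorem IsPotential.congr {V : Type*} [Fintype V] {G : SimpleGraph V} {v : V}
    {f f' u : V → ℝ} (hu : G.IsPotential v f u) (h : ∀ y, y ≠ v → f y = f' y) :
    G.IsPotential v f' u :=
  ⟨hu.1, fun y hy => (hu.2 y hy).trans (h y hy)⟩

theorem IsPotential.sum {V ι : Type*} [Fintype V] [Fintype ι] {G : SimpleGraph V} {v : V}
    {f u : ι → V → ℝ} (hu : ∀ k, G.IsPotential v (f k) (u k)) (c : ι → ℝ) :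
    G.IsPotential v (fun y => ∑ k, c k * f k y) (fun y => ∑ k, c k * u k y) := by
  refine ⟨by simp [fun k => (hu k).1], fun y hy => ?_⟩
  simp_rw [← (hu _).2 y hy, ← Finset.sum_sub_distrib, Finset.mul_sum]
  rw [Finset.sum_comm]
  refine Finset.sum_congr rfl fun k _ => Finset.sum_congr rfl fun z _ => ?_
  ring

/-! ### Spanning forests with two components solve a Dirichlet problem -/

theorem reachable_iff_not_reachable_of_card_eq_two {V : Type*} {H : SimpleGraph V}
    (h2 : Nat.card H.ConnectedComponent = 2) {y z : V} (hyz : ¬ H.Reachable y z) (w : V) :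
    H.Reachable w y ↔ ¬ H.Reachable w z := by
  constructor
  · exact fun h1 h2 => hyz (h1.symm.trans h2)
  · intro h
    obtain ⟨c, d, hcd, hu⟩ := Nat.card_eq_two_iff.mp h2
    have hm : ∀ x : V, H.connectedComponentMk x = c ∨ H.connectedComponentMk x = d := fun x => by
      have : H.connectedComponentMk x ∈ ({c, d} : Set H.ConnectedComponent) := by
        rw [hu]; trivial
      simpa using this
    rw [← ConnectedComponent.eq] at h hyz ⊢
    rcases hm w with h1 | h1 <;> rcases hm y with h2 | h2 <;> rcases hm z with h3 | h3 <;>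
      simp_all

theorem isTree_sup_edge {V : Type*} {H : SimpleGraph V} (hH : H.IsAcyclic)
    (h2 : Nat.card H.ConnectedComponent = 2) {y z : V} (hyz : ¬ H.Reachable y z) :
    (H ⊔ edge y z).IsTree := by
  have hne : y ≠ z := fun h => hyz (h ▸ Reachable.refl _)
  have hadj : (H ⊔ edge y z).Adj z y := by
    simp [sup_adj, edge_adj, hne.symm]
  have hr : ∀ w, (H ⊔ edge y z).Reachable w y := fun w => by
    by_cases hw : H.Reachable w z
    · exact (hw.mono le_sup_left).trans hadj.reachable
    · exact ((reachable_iff_not_reachable_of_card_eq_two h2 hyz w).mpr hw).mono le_sup_left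
  have : Nonempty V := ⟨y⟩
  exact ⟨⟨fun a b => (hr a).trans (hr b).symm⟩, hH.sup_edge_of_not_reachable hyz⟩

theorem IsTree.not_reachable_deleteEdges {V : Type*} {T : SimpleGraph V} (hT : T.IsTree) {y z : V}
    (h : T.Adj y z) : ¬ (T.deleteEdges {s(y, z)}).Reachable y z :=
  isBridge_iff.mp (isAcyclic_iff_forall_adj_isBridge.mp hT.isAcyclic h)

theorem Connected.reachable_deleteEdges_or {V : Type*} {T : SimpleGraph V} (hT : T.Connected)
    (y z w : V) : (T.deleteEdges {s(y, z)}).Reachable w y ∨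
      (T.deleteEdges {s(y, z)}).Reachable w z := by
  obtain ⟨p⟩ := hT.preconnected w y
  induction p with
  | nil => exact Or.inl (Reachable.refl _)
  | @cons a b c hab p ih =>
    by_cases he : s(a, b) = s(c, z)
    · rw [Sym2.eq_iff] at he
      rcases he with ⟨rfl, -⟩ | ⟨rfl, -⟩
      · exact Or.inl (Reachable.refl _)
      · exact Or.inr (Reachable.refl _)
    · have hadj : (T.deleteEdges {s(c, z)}).Adj a b := by
        simp only [deleteEdges_adj, Set.mem_singleton_iff]
        exact ⟨hab, he⟩
      exact ih.imp hadj.reachable.trans hadj.reachable.trans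

theorem IsTree.card_connectedComponent_deleteEdges {V : Type*} {T : SimpleGraph V} (hT : T.IsTree)
    {y z : V} (h : T.Adj y z) :
    Nat.card (T.deleteEdges {s(y, z)}).ConnectedComponent = 2 := by
  rw [Nat.card_eq_two_iff]
  refine ⟨connectedComponentMk _ y, connectedComponentMk _ z, ?_, ?_⟩
  · rw [Ne, ConnectedComponent.eq]
    exact hT.not_reachable_deleteEdges h
  · rw [Set.eq_univ_iff_forall]
    intro c
    induction c using ConnectedComponent.ind with
    | h w =>
      rw [Set.mem_insert_iff, Set.mem_singleton_iff, ConnectedComponent.eq, ConnectedComponent.eq]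
      exact hT.1.reachable_deleteEdges_or y z w

/-- In a tree, exactly one edge at `y` separates `y` from a given other vertex. -/
theorem IsTree.existsUnique_adj_not_reachable {V : Type*} {T : SimpleGraph V} (hT : T.IsTree)
    {y w : V} (hyw : y ≠ w) :
    ∃! z, T.Adj y z ∧ ¬ (T.deleteEdges {s(y, z)}).Reachable w y := by
  obtain ⟨p, hp, hpu⟩ := hT.existsUnique_path y w
  cases p with
  | nil => exact absurd rfl hyw
  | @cons _ z _ hz p =>
    -- The separating edge is the first edge of the unique path from `y` to `w`. If `w` stayed
    -- connected to `y` without it, there would be a second path; any other edge at `y` is avoided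
    -- by the path itself.
    refine ⟨z, ⟨hz, fun hr => ?_⟩, fun z' ⟨hz', hr⟩ => ?_⟩
    · obtain ⟨q, hq⟩ := hr.symm.exists_isPath
      have h1 := hpu (q.mapLe (deleteEdges_le _)) (hq.mapLe _)
      have h2 : s(y, z) ∈ (q.mapLe (deleteEdges_le {s(y, z)})).edges := by
        rw [h1]; simp
      rw [Walk.edges_mapLe_eq_edges] at h2
      have h3 := q.adj_of_mem_edges h2
      simp at h3
    · by_contra hne
      refine hr (Walk.toDeleteEdges {s(y, z')} (Walk.cons hz p) ?_).reachable.symm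
      intro e he hes
      rw [Set.mem_singleton_iff] at hes
      subst hes
      rw [Walk.edges_cons, List.mem_cons] at he
      rcases he with he | he
      · rw [Sym2.eq_iff] at he
        rcases he with ⟨-, h⟩ | ⟨h, -⟩
        · exact hne h
        · exact hz.ne h
      · exact ((Walk.cons_isPath_iff _ _).mp hp).2 (p.fst_mem_support_of_mem_edges he)

/-! ### Double counting of two-component forests and spanning trees -/

open Classical in
/-- The spanning trees of `G`. -/
noncomputable def spanningTrees {V : Type*} [Fintype V] (G : SimpleGraph V) :
    Finset (SimpleGraph V) := {T | T ≤ G ∧ T.IsTree}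

open Classical in
/-- The spanning forests of `G` with exactly two components. -/
noncomputable def twoForests {V : Type*} [Fintype V] (G : SimpleGraph V) :
    Finset (SimpleGraph V) := {H | H ≤ G ∧ H.IsAcyclic ∧ Nat.card H.ConnectedComponent = 2}

open Classical in
/-- The number of spanning forests of `G` with exactly two components, one of which contains `x`
and `y`, and the other `v`. -/
noncomputable def numForestsSeparating {V : Type*} [Fintype V] (G : SimpleGraph V) (v x y : V) :
    ℝ := ∑ H ∈ G.twoForests, if H.Reachable x y ∧ ¬ H.Reachable x v then 1 else 0

theorem numSpanningTrees_eq {V : Type*} [Fintype V] (G : SimpleGraph V) :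
    G.numSpanningTrees = G.spanningTrees.card := by
  classical
  rw [numSpanningTrees, Set.ncard_eq_toFinset_card']
  congr 1
  ext T
  simp [spanningTrees]

theorem Connected.numSpanningTrees_pos {V : Type*} [Fintype V] {G : SimpleGraph V}
    (hG : G.Connected) : 0 < G.numSpanningTrees := by
  rw [numSpanningTrees_eq, Finset.card_pos]
  obtain ⟨T, h⟩ := hG.exists_isTree_le
  exact ⟨T, by simpa [spanningTrees] using h⟩

theorem numTwoForests_eq {V : Type*} [Fintype V] (G : SimpleGraph V) (x v : V) :
    (G.numTwoForests x v : ℝ) = G.numForestsSeparating v x x := by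
  classical
  rw [numTwoForests, Set.ncard_eq_toFinset_card', numForestsSeparating, Finset.sum_boole]
  congr 2
  ext T
  simp [twoForests, and_assoc]

open Classical in
-- Inserting the edge yz into a forest that separates its ends gives a spanning tree through yz, and
-- deleting it is the inverse.
theorem sum_twoForests_eq_sum_spanningTrees {V : Type*} [Fintype V] (G : SimpleGraph V) {y z : V}
    (hyz : G.Adj y z) (φ : SimpleGraph V → ℝ) :
    ∑ H ∈ G.twoForests with ¬ H.Reachable y z, φ H =
      ∑ T ∈ G.spanningTrees with T.Adj y z, φ (T.deleteEdges {s(y, z)}) := by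
  have hdel : ∀ H : SimpleGraph V, ¬ H.Reachable y z →
      (H ⊔ edge y z).deleteEdges {s(y, z)} = H := by
    intro H hH
    ext a b
    have h1 : ¬ H.Adj y z := fun h => hH h.reachable
    have h2 : ¬ H.Adj z y := fun h => hH h.symm.reachable
    simp only [deleteEdges_adj, sup_adj, edge_adj, Set.mem_singleton_iff, Sym2.eq_iff]
    constructor
    · rintro ⟨h | h, h'⟩
      · exact h
      · exact absurd h.1 h'
    · intro h
      refine ⟨Or.inl h, ?_⟩
      rintro (⟨rfl, rfl⟩ | ⟨rfl, rfl⟩) <;> contradiction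
  refine Finset.sum_bij' (fun H _ => H ⊔ edge y z) (fun T _ => T.deleteEdges {s(y, z)})
    ?_ ?_ ?_ ?_ ?_
  · intro H hH
    simp only [twoForests, spanningTrees, Finset.mem_filter, Finset.mem_univ, true_and] at hH ⊢
    refine ⟨⟨sup_le hH.1.1 ?_, isTree_sup_edge hH.1.2.1 hH.1.2.2 hH.2⟩, ?_⟩
    · intro a b hab
      rw [edge_adj] at hab
      rcases hab.1 with ⟨rfl, rfl⟩ | ⟨rfl, rfl⟩
      · exact hyz
      · exact hyz.symm
    · simp [edge_adj, hyz.ne]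
  · intro T hT
    simp only [twoForests, spanningTrees, Finset.mem_filter, Finset.mem_univ, true_and] at hT ⊢
    exact ⟨⟨(deleteEdges_le _).trans hT.1.1, hT.1.2.isAcyclic.anti (deleteEdges_le _),
      hT.1.2.card_connectedComponent_deleteEdges hT.2⟩, hT.1.2.not_reachable_deleteEdges hT.2⟩
  · intro H hH
    exact hdel H (Finset.mem_filter.mp hH).2
  · intro T hT
    have hT := (Finset.mem_filter.mp hT).2
    ext a b
    simp only [deleteEdges_adj, sup_adj, edge_adj, Set.mem_singleton_iff, Sym2.eq_iff]
    constructor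
    · rintro (h | ⟨⟨rfl, rfl⟩ | ⟨rfl, rfl⟩, -⟩)
      · exact h.1
      · exact hT
      · exact hT.symm
    · intro h
      have := h.ne
      tauto
  · intro H hH
    rw [hdel H (Finset.mem_filter.mp hH).2]

open Classical in
theorem IsTree.sum_reachable_deleteEdges {V : Type*} [Fintype V] {T : SimpleGraph V}
    (hT : T.IsTree) (y w : V) :
    ∑ z with T.Adj y z, (if (T.deleteEdges {s(y, z)}).Reachable w y then (1 : ℝ) else 0) =
      (({z | T.Adj y z} : Finset V).card : ℝ) - if y = w then 0 else 1 := by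
  have h1 : ∀ z, (if (T.deleteEdges {s(y, z)}).Reachable w y then (1 : ℝ) else 0) =
      1 - if ¬ (T.deleteEdges {s(y, z)}).Reachable w y then (1 : ℝ) else 0 := by
    intro z; split_ifs <;> simp
  simp_rw [h1]
  rw [Finset.sum_sub_distrib, Finset.sum_const, nsmul_eq_mul, mul_one, Finset.sum_boole,
    Finset.filter_filter]
  congr 1
  split_ifs with h
  · subst h
    rw [Nat.cast_eq_zero, Finset.card_eq_zero, Finset.filter_eq_empty_iff]
    exact fun z _ h => h.2 (Reachable.refl _)
  · rw [Nat.cast_eq_one, Finset.card_eq_one]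
    obtain ⟨z, hz, hu⟩ := hT.existsUnique_adj_not_reachable h
    refine ⟨z, ?_⟩
    ext z'
    simp only [Finset.mem_filter, Finset.mem_univ, true_and, Finset.mem_singleton]
    exact ⟨fun h => hu z' h, fun h => h ▸ hz⟩

open Classical in
-- A forest that joins `y` to `z` contributes nothing to the difference. One that separates them
-- contributes [x ~ y] - [v ~ y], where ~ means lying in the same component. Pass to trees T through
-- yz and sum over `z`: of the deg_T(y) edges at `y`, all but the one leading towards `x` keep `x`
-- with `y`, and likewise for `v`. So each tree contributes (deg_T(y) - [y ≠ x]) - (deg_T(y) - 1) =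
-- [y = x].
theorem sum_numForestsSeparating_sub {V : Type*} [Fintype V] (G : SimpleGraph V) {v y : V}
    (hy : y ≠ v) (x : V) :
    ∑ z ∈ G.neighborFinset y, (G.numForestsSeparating v x y - G.numForestsSeparating v x z) =
      if y = x then (G.numSpanningTrees : ℝ) else 0 := by
  have h1 : ∀ z ∈ G.neighborFinset y,
      G.numForestsSeparating v x y - G.numForestsSeparating v x z =
      ∑ T ∈ G.spanningTrees with T.Adj y z,
        ((if (T.deleteEdges {s(y, z)}).Reachable x y then (1 : ℝ) else 0) -
          if (T.deleteEdges {s(y, z)}).Reachable v y then (1 : ℝ) else 0) := by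
    intro z hz
    rw [mem_neighborFinset] at hz
    refine Eq.trans ?_ ((G.sum_twoForests_eq_sum_spanningTrees hz fun H =>
        (if H.Reachable x y then (1 : ℝ) else 0) -
          if H.Reachable v y then (1 : ℝ) else 0).trans (by congr!))
    rw [numForestsSeparating, numForestsSeparating, ← Finset.sum_sub_distrib, Finset.sum_filter]
    refine Finset.sum_congr rfl fun H hH => ?_
    simp only [twoForests, Finset.mem_filter, Finset.mem_univ, true_and] at hH
    by_cases hr : H.Reachable y z
    · have : H.Reachable x y ↔ H.Reachable x z :=
        ⟨fun h => h.trans hr, fun h => h.trans hr.symm⟩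
      simp [this, hr]
    · have hx := reachable_iff_not_reachable_of_card_eq_two hH.2.2 hr x
      have hv := reachable_iff_not_reachable_of_card_eq_two hH.2.2 hr v
      have hxv : H.Reachable x v ↔ (H.Reachable x y ↔ H.Reachable v y) := by
        constructor
        · exact fun h => ⟨h.symm.trans, h.trans⟩
        · intro h
          by_cases h' : H.Reachable x y
          · exact h'.trans (h.mp h').symm
          · have h1 : H.Reachable x z := by tauto
            have h2 : H.Reachable v z := by tauto
            exact h1.trans h2.symm
      simp only [hxv, hx, hv]
      by_cases h1 : H.Reachable x z <;> by_cases h2 : H.Reachable v z <;> simp [h1, h2, hr]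
  rw [Finset.sum_congr rfl h1]
  simp_rw [Finset.sum_filter]
  rw [Finset.sum_comm, numSpanningTrees_eq]
  have h2 : ∀ T ∈ G.spanningTrees,
      (∑ z ∈ G.neighborFinset y, if T.Adj y z then
        ((if (T.deleteEdges {s(y, z)}).Reachable x y then (1 : ℝ) else 0) -
          if (T.deleteEdges {s(y, z)}).Reachable v y then (1 : ℝ) else 0) else 0) =
      if y = x then 1 else 0 := by
    intro T hT
    simp only [spanningTrees, Finset.mem_filter, Finset.mem_univ, true_and] at hT
    rw [← Finset.sum_filter]
    have hs : (G.neighborFinset y).filter (T.Adj y) = ({z | T.Adj y z} : Finset V) := by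
      ext z
      simp only [Finset.mem_filter, mem_neighborFinset, Finset.mem_univ, true_and,
        and_iff_right_iff_imp]
      exact fun h => hT.1 h
    rw [hs, Finset.sum_sub_distrib, hT.2.sum_reachable_deleteEdges,
      hT.2.sum_reachable_deleteEdges, if_neg hy]
    split_ifs <;> ring
  rw [Finset.sum_congr rfl h2, Finset.sum_const, nsmul_eq_mul, mul_ite, mul_one, mul_zero]

open Classical in
/-- Normalised forest counts form the Green function of `G` grounded at `v`. -/
theorem Connected.isPotential_numForestsSeparating {V : Type*} [Fintype V] {G : SimpleGraph V}
    (hG : G.Connected) (v x : V) :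
    G.IsPotential v (fun y => if y = x then 1 else 0)
      (fun y => G.numForestsSeparating v x y / G.numSpanningTrees) := by
  have hτ : (G.numSpanningTrees : ℝ) ≠ 0 := by exact_mod_cast hG.numSpanningTrees_pos.ne'
  constructor
  · simp [numForestsSeparating]
  · intro y hy
    simp_rw [← sub_div]
    rw [← Finset.sum_div, sum_numForestsSeparating_sub G hy]
    split_ifs <;> simp [hτ]

open Classical in
-- By uniqueness the forest counts may be replaced by any explicit Green function; this is how
-- moments are computed below.
theorem Connected.moment_eq {V : Type*} [Fintype V] [DecidableEq V] {G : SimpleGraph V} (hG : G.Connected) {v : V}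
    {u : V → V → ℝ} (hu : ∀ x, G.IsPotential v (fun y => if y = x then 1 else 0) (u x)) :
    G.moment v = ∑ x, (G.degree x : ℝ) * u x x := by
  rw [moment, Finset.mul_sum]
  refine Finset.sum_congr rfl fun x _ => ?_
  rw [hG.isPotential_unique (hu x) ((hG.isPotential_numForestsSeparating v x).congr
    fun y _ => by congr), numTwoForests_eq]
  ring

/-! ### Kemeny's constant from a grounded Green function -/

open Classical in
theorem Connected.isPotential_meanFirstPassage {V : Type*} [Fintype V] {G : SimpleGraph V}
    (hG : G.Connected) (v : V) :
    G.IsPotential v (fun y => G.degree y) (fun y => (G.meanFirstPassage y v).toReal) := by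
  refine ⟨by simp [meanFirstPassage_self], fun y hy => ?_⟩
  have : Nontrivial V := ⟨y, v, hy⟩
  rw [sum_neighborFinset_sub G fun y => (G.meanFirstPassage y v).toReal,
    hG.toReal_meanFirstPassage hy]
  ring

open Classical in
theorem sum_sum_neighborFinset_comm {V : Type*} [Fintype V] (G : SimpleGraph V) (f : V → V → ℝ) :
    ∑ y, ∑ z ∈ G.neighborFinset y, f y z = ∑ y, ∑ z ∈ G.neighborFinset y, f z y := by
  simp_rw [neighborFinset_eq_filter, Finset.sum_filter]
  rw [Finset.sum_comm]
  simp_rw [G.adj_comm]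

open Classical in
theorem sum_sum_neighborFinset_sub {V : Type*} [Fintype V] (G : SimpleGraph V) (f : V → ℝ) :
    ∑ y, ∑ z ∈ G.neighborFinset y, (f y - f z) = 0 := by
  have h := G.sum_sum_neighborFinset_comm fun y z => f y - f z
  have h2 : ∑ y, ∑ z ∈ G.neighborFinset y, (f z - f y) =
      - ∑ y, ∑ z ∈ G.neighborFinset y, (f y - f z) := by
    simp_rw [← Finset.sum_neg_distrib, neg_sub]
  linarith

open Classical in
theorem sum_degree_eq {V : Type*} [Fintype V] (G : SimpleGraph V) :
    ∑ x, (G.degree x : ℝ) = 2 * (G.edgeFinset.card : ℝ) := by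
  exact_mod_cast G.sum_degrees_eq_twice_card_edges

open Classical in
-- The Laplacian of any function sums to zero over all vertices, which determines its value at the
-- grounded vertex.
theorem IsPotential.sum_neighborFinset_sub_self {V : Type*} [Fintype V] {G : SimpleGraph V} {v : V}
    {f u : V → ℝ} (hu : G.IsPotential v f u) :
    ∑ z ∈ G.neighborFinset v, (u v - u z) = f v - ∑ y, f y := by
  have h := G.sum_sum_neighborFinset_sub u
  rw [← Finset.add_sum_erase _ _ (Finset.mem_univ v),
    Finset.sum_congr rfl fun y hy => hu.2 y (Finset.ne_of_mem_erase hy)] at h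
  rw [← Finset.add_sum_erase _ f (Finset.mem_univ v)]
  linarith

open Classical in
theorem Connected.meanFirstPassage_eq {V : Type*} [Fintype V] {G : SimpleGraph V}
    (hG : G.Connected) {v x : V} {u H : V → ℝ}
    (hu : G.IsPotential v (fun y => if y = x then 1 else 0) u)
    (hH : G.IsPotential v (fun y => G.degree y) H) :
    (G.meanFirstPassage v x).toReal = 2 * (G.edgeFinset.card : ℝ) * u x - H x := by
  -- Off `v`, the Laplacian of H - 2|E| u is deg - 2|E| δ_x; at `v` it is (deg v - 2|E|) + 2|E| =
  -- deg v. Shifted so as to vanish at `x`, the function solves the hitting-time equations of `x`,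
  -- and it is then evaluated at `v`, where H and u vanish.
  have key : G.IsPotential x (fun y => G.degree y) (fun y =>
      H y - 2 * (G.edgeFinset.card : ℝ) * u y +
        (2 * (G.edgeFinset.card : ℝ) * u x - H x)) := by
    refine ⟨by ring, fun y hy => ?_⟩
    have h1 : ∀ z, H y - 2 * (G.edgeFinset.card : ℝ) * u y +
          (2 * (G.edgeFinset.card : ℝ) * u x - H x) -
        (H z - 2 * (G.edgeFinset.card : ℝ) * u z +
          (2 * (G.edgeFinset.card : ℝ) * u x - H x)) =
        (H y - H z) - 2 * (G.edgeFinset.card : ℝ) * (u y - u z) := fun z => by ring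
    simp_rw [h1]
    rw [Finset.sum_sub_distrib, ← Finset.mul_sum]
    by_cases hyv : y = v
    · subst hyv
      rw [hu.sum_neighborFinset_sub_self, hH.sum_neighborFinset_sub_self, sum_degree_eq,
        if_neg hy, Finset.sum_ite_eq']
      simp
    · rw [hH.2 y hyv, hu.2 y hyv]
      simp [hy]
  have := congrFun (hG.isPotential_unique (hG.isPotential_meanFirstPassage x) key) v
  simpa [hu.1, hH.1] using this

theorem Connected.card_edgeFinset_pos {V : Type*} [Fintype V] [Nontrivial V]
    {G : SimpleGraph V} [Fintype G.edgeSet] (hG : G.Connected) : 0 < G.edgeFinset.card := by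
  classical
  obtain ⟨x⟩ := hG.nonempty
  obtain ⟨y, hy⟩ := (G.degree_pos_iff_exists_adj x).mp
    (hG.preconnected.degree_pos_of_nontrivial x)
  exact Finset.card_pos.mpr ⟨s(x, y), by simpa using hy⟩

open Classical in
/-- Kemeny's constant is the moment of a vertex minus the mean hitting time of that vertex from
the stationary distribution. -/
theorem Connected.kemeny_eq {V : Type*} [Fintype V] [Nontrivial V] {G : SimpleGraph V}
    (hG : G.Connected) {v : V} {H : V → ℝ} (hH : G.IsPotential v (fun y => G.degree y) H) :
    G.kemeny = G.moment v - (∑ x, (G.degree x : ℝ) * H x) / (2 * (G.edgeFinset.card : ℝ)) := by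
  have hm : (G.edgeFinset.card : ℝ) ≠ 0 := by exact_mod_cast hG.card_edgeFinset_pos.ne'
  rw [← hG.kemenyFrom_eq_kemeny v, kemenyFrom,
    hG.moment_eq (hG.isPotential_numForestsSeparating v), Finset.sum_div,
    ← Finset.sum_sub_distrib]
  refine Finset.sum_congr rfl fun x _ => ?_
  rw [hG.meanFirstPassage_eq (hG.isPotential_numForestsSeparating v x) hH, stationaryProb]
  field_simp

/-! ### Gluing two graphs at a vertex -/

/-- `G` is obtained from disjoint copies of `G₁` and `G₂` by identifying `v₁` with `v₂`. -/
structure IsOneSum {V V₁ V₂ : Type*} (G : SimpleGraph V) (G₁ : SimpleGraph V₁)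
    (G₂ : SimpleGraph V₂) (p : V₁ ↪ V) (q : V₂ ↪ V) (v₁ : V₁) (v₂ : V₂) : Prop where
  eq_sup : G = G₁.map p ⊔ G₂.map q
  root : p v₁ = q v₂
  cover : ∀ y, y ∈ Set.range p ∨ y ∈ Set.range q
  eq_root : ∀ y₁ y₂, p y₁ = q y₂ → y₁ = v₁ ∧ y₂ = v₂

namespace IsOneSum

variable {V V₁ V₂ : Type*} {G : SimpleGraph V} {G₁ : SimpleGraph V₁} {G₂ : SimpleGraph V₂}
  {p : V₁ ↪ V} {q : V₂ ↪ V} {v₁ : V₁} {v₂ : V₂}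

theorem symm (h : IsOneSum G G₁ G₂ p q v₁ v₂) : IsOneSum G G₂ G₁ q p v₂ v₁ where
  eq_sup := h.eq_sup.trans (sup_comm _ _)
  root := h.root.symm
  cover y := (h.cover y).symm
  eq_root y₂ y₁ e := (h.eq_root y₁ y₂ e.symm).symm

theorem connected (h : IsOneSum G G₁ G₂ p q v₁ v₂) (h₁ : G₁.Connected) (h₂ : G₂.Connected) :
    G.Connected := by
  have hr : ∀ y, G.Reachable y (p v₁) := by
    intro y
    rcases h.cover y with ⟨y, rfl⟩ | ⟨y, rfl⟩
    · exact ((h₁.preconnected y v₁).map (Embedding.map p G₁).toHom).mono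
        (h.eq_sup ▸ le_sup_left)
    · rw [h.root]
      exact ((h₂.preconnected y v₂).map (Embedding.map q G₂).toHom).mono
        (h.eq_sup ▸ le_sup_right)
  have : Nonempty V := ⟨p v₁⟩
  exact ⟨fun y z => (hr y).trans (hr z).symm⟩

theorem adj_iff (h : IsOneSum G G₁ G₂ p q v₁ v₂) {y : V₁} (hy : y ≠ v₁) (z : V) :
    G.Adj (p y) z ↔ ∃ z₁, G₁.Adj y z₁ ∧ p z₁ = z := by
  rw [h.eq_sup, sup_adj, map_adj, map_adj]
  constructor
  · rintro (⟨y', z', hyz, h1, h2⟩ | ⟨y', z', -, h1, -⟩)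
    · rw [← p.injective h1]
      exact ⟨z', hyz, h2⟩
    · exact absurd (h.eq_root y y' h1.symm).1 hy
  · rintro ⟨z₁, h1, h2⟩
    exact Or.inl ⟨y, z₁, h1, rfl, h2⟩

variable [Fintype V] [Fintype V₁]

open Classical in
theorem neighborFinset_eq (h : IsOneSum G G₁ G₂ p q v₁ v₂) {y : V₁} (hy : y ≠ v₁) :
    G.neighborFinset (p y) = (G₁.neighborFinset y).map p := by
  ext z
  simp [h.adj_iff hy]

open Classical in
theorem degree_eq (h : IsOneSum G G₁ G₂ p q v₁ v₂) {y : V₁} (hy : y ≠ v₁) :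
    G.degree (p y) = G₁.degree y := by
  rw [← card_neighborFinset_eq_degree, h.neighborFinset_eq hy, Finset.card_map,
    card_neighborFinset_eq_degree]

/-- Away from the common vertex a vertex of one part has all its neighbours in that part, so
grounding the common vertex decouples the Dirichlet problem. -/
theorem isPotential_comp (h : IsOneSum G G₁ G₂ p q v₁ v₂) {f u : V → ℝ}
    (hu : G.IsPotential (p v₁) f u) : G₁.IsPotential v₁ (f ∘ p) (u ∘ p) := by
  refine ⟨hu.1, fun y hy => ?_⟩
  have := hu.2 (p y) (p.injective.ne hy)
  rwa [h.neighborFinset_eq hy, Finset.sum_map] at this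

variable [Fintype V₂]

/-- The common vertex is counted twice on the right, hence the assumption that `f` vanishes there.
-/
theorem sum_eq (h : IsOneSum G G₁ G₂ p q v₁ v₂) {f : V → ℝ} (hf : f (p v₁) = 0) :
    ∑ y, f y = ∑ y, f (p y) + ∑ y, f (q y) := by
  classical
  have hu : Finset.univ = Finset.univ.map p ∪ Finset.univ.map q := by
    ext y
    simpa using h.cover y
  have hi : Finset.univ.map p ∩ Finset.univ.map q = {p v₁} := by
    ext y
    simp only [Finset.mem_inter, Finset.mem_map, Finset.mem_univ, true_and,
      Finset.mem_singleton]
    constructor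
    · rintro ⟨⟨y₁, rfl⟩, y₂, e⟩
      rw [(h.eq_root y₁ y₂ e.symm).1]
    · rintro rfl
      exact ⟨⟨v₁, rfl⟩, v₂, h.root.symm⟩
  have := Finset.sum_union_inter (s₁ := Finset.univ.map p) (s₂ := Finset.univ.map q) (f := f)
  rw [← hu, hi, Finset.sum_singleton, hf, add_zero, Finset.sum_map, Finset.sum_map] at this
  exact this

open Classical in
theorem sum_degree_mul (h : IsOneSum G G₁ G₂ p q v₁ v₂) {f : V → ℝ} (hf : f (p v₁) = 0) :
    ∑ y, (G.degree y : ℝ) * f y =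
      ∑ y, (G₁.degree y : ℝ) * f (p y) + ∑ y, (G₂.degree y : ℝ) * f (q y) := by
  rw [h.sum_eq (by rw [hf, mul_zero])]
  congr 1 <;> refine Finset.sum_congr rfl fun y _ => ?_
  · by_cases hy : y = v₁
    · rw [hy, hf, mul_zero, mul_zero]
    · rw [h.degree_eq hy]
  · by_cases hy : y = v₂
    · rw [hy, ← h.root, hf, mul_zero, mul_zero]
    · rw [h.symm.degree_eq hy]

open Classical in
theorem card_edgeFinset (h : IsOneSum G G₁ G₂ p q v₁ v₂) :
    G.edgeFinset.card = G₁.edgeFinset.card + G₂.edgeFinset.card := by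
  have hd : Disjoint (G₁.map p).edgeFinset (G₂.map q).edgeFinset := by
    rw [disjoint_edgeFinset, disjoint_iff_inf_le]
    intro y z hyz
    rw [inf_adj, map_adj, map_adj] at hyz
    obtain ⟨⟨y₁, z₁, -, rfl, rfl⟩, y₂, z₂, hyz, hy, hz⟩ := hyz
    exact hyz.ne ((h.eq_root _ _ hy.symm).2.trans (h.eq_root _ _ hz.symm).2.symm)
  have hs : G.edgeFinset = (G₁.map p).edgeFinset ∪ (G₂.map q).edgeFinset := by
    rw [← edgeFinset_sup, edgeFinset_inj]
    exact h.eq_sup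
  rw [hs, Finset.card_union_of_disjoint hd]
  congr 1 <;> convert card_edgeFinset_map _ _

theorem moment_eq (h : IsOneSum G G₁ G₂ p q v₁ v₂) (h₁ : G₁.Connected) (h₂ : G₂.Connected) :
    G.moment (p v₁) = G₁.moment v₁ + G₂.moment v₂ := by
  classical
  have hu := (h.connected h₁ h₂).isPotential_numForestsSeparating (p v₁)
  have hu' := hu
  rw [h.root] at hu'
  rw [(h.connected h₁ h₂).moment_eq hu,
    h₁.moment_eq fun x => (h.isPotential_comp (hu (p x))).congr fun y _ => by simp,
    h₂.moment_eq fun x => (h.symm.isPotential_comp (hu' (q x))).congr fun y _ => by simp]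
  rw [h.sum_degree_mul (by simp [numForestsSeparating])]
  simp [h.root]

open Classical in
-- Moments, hitting sums and edge counts are all additive; the two parts interact only through the
-- quotient of the last two.
theorem kemeny_eq [Nontrivial V] (h : IsOneSum G G₁ G₂ p q v₁ v₂) (h₁ : G₁.Connected)
    (h₂ : G₂.Connected) {H₁ : V₁ → ℝ} {H₂ : V₂ → ℝ}
    (hH₁ : G₁.IsPotential v₁ (fun y => G₁.degree y) H₁)
    (hH₂ : G₂.IsPotential v₂ (fun y => G₂.degree y) H₂) :
    G.kemeny = G₁.moment v₁ + G₂.moment v₂ -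
      (∑ y, (G₁.degree y : ℝ) * H₁ y + ∑ y, (G₂.degree y : ℝ) * H₂ y) /
        (2 * ((G₁.edgeFinset.card : ℝ) + G₂.edgeFinset.card)) := by
  have hG := h.connected h₁ h₂
  have hH := hG.isPotential_meanFirstPassage (p v₁)
  have hH' := hG.isPotential_meanFirstPassage (q v₂)
  rw [hG.kemeny_eq hH, h.moment_eq h₁ h₂, h.card_edgeFinset,
    h.sum_degree_mul (by simp [meanFirstPassage_self]),
    h₁.isPotential_unique hH₁ ((h.isPotential_comp hH).congr fun y hy => by
      simp [h.degree_eq hy]),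
    h₂.isPotential_unique hH₂ ((h.symm.isPotential_comp hH').congr fun y hy => by
      simp [h.symm.degree_eq hy])]
  simp [h.root]

end IsOneSum

/-! ### The spider graph -/

theorem spider_adj_none_some {a b : ℕ} {l : Fin b} {k : Fin a} :
    (spider a b).Adj none (some (l, k)) ↔ (k : ℕ) = 0 := by
  simp [spider, fromRel_adj]

theorem spider_adj_some_none {a b : ℕ} {l : Fin b} {k : Fin a} :
    (spider a b).Adj (some (l, k)) none ↔ (k : ℕ) = 0 := by
  rw [adj_comm, spider_adj_none_some]

theorem spider_adj_some_some {a b : ℕ} {l l' : Fin b} {k k' : Fin a} :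
    (spider a b).Adj (some (l, k)) (some (l', k')) ↔
      l = l' ∧ ((k : ℕ) + 1 = k' ∨ (k' : ℕ) + 1 = k) := by
  simp only [spider, fromRel_adj, ne_eq, Option.some.injEq, Prod.mk.injEq, Fin.ext_iff]
  constructor
  · rintro ⟨-, h | h⟩
    · exact ⟨h.1, Or.inl h.2⟩
    · exact ⟨h.1.symm, Or.inr h.2⟩
  · rintro ⟨h, h' | h'⟩
    · exact ⟨by omega, Or.inl ⟨h, h'⟩⟩
    · exact ⟨by omega, Or.inr ⟨h.symm, h'⟩⟩

theorem connected_spider (a b : ℕ) : (spider a b).Connected := by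
  have hr : ∀ (l : Fin b) (k : ℕ) (hk : k < a), (spider a b).Reachable (some (l, ⟨k, hk⟩)) none := by
    intro l k
    induction k with
    | zero => exact fun hk => (spider_adj_some_none.mpr rfl : (spider a b).Adj _ _).reachable
    | succ k ih =>
      intro hk
      exact (spider_adj_some_some.mpr ⟨rfl, Or.inr rfl⟩ : (spider a b).Adj
        (some (l, ⟨k + 1, hk⟩)) (some (l, ⟨k, by omega⟩))).reachable.trans (ih (by omega))
  have hr' : ∀ y, (spider a b).Reachable y none := by
    rintro (_ | ⟨l, k⟩)
    · exact Reachable.refl _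
    · exact hr l k k.2
  exact ⟨fun y z => (hr' y).trans (hr' z).symm⟩

/-- The distance of a vertex of the spider from the center. -/
def spiderHeight {a b : ℕ} : Option (Fin b × Fin a) → ℕ
  | none => 0
  | some (_, k) => k + 1

open Classical in
theorem sum_neighborFinset_spider_some {a b : ℕ} (F : ℕ → ℝ) (l : Fin b) (k : Fin a) :
    ∑ z ∈ (spider a b).neighborFinset (some (l, k)), F (spiderHeight z) =
      F k + if (k : ℕ) + 1 < a then F (k + 2) else 0 := by
  obtain ⟨k, hk⟩ := k
  -- `d` is the neighbour towards the center: the center itself when `k = 0`, else the preceding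
  -- vertex of the leg. Its height is `k` in both cases.
  have hdown : ∃ d : Option (Fin b × Fin a), spiderHeight d = k ∧
      ∀ z, ((spider a b).Adj (some (l, ⟨k, hk⟩)) z ↔
        z = d ∨ ∃ h : k + 1 < a, z = some (l, ⟨k + 1, h⟩)) := by
    rcases k with _ | k
    · refine ⟨none, rfl, ?_⟩
      rintro (_ | ⟨l', k'⟩)
      · simp [spider_adj_some_none]
      · simp only [spider_adj_some_some, reduceCtorEq, false_or, Option.some.injEq,
          Prod.mk.injEq, Fin.ext_iff]
        constructor
        · rintro ⟨h, h' | h'⟩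
          · have := k'.2
            exact ⟨by omega, h.symm, h'.symm⟩
          · exact h'.elim
        · rintro ⟨-, h, h'⟩
          exact ⟨h.symm, Or.inl h'.symm⟩
    · refine ⟨some (l, ⟨k, by omega⟩), rfl, ?_⟩
      rintro (_ | ⟨l', k'⟩)
      · simp [spider_adj_some_none]
      · simp only [spider_adj_some_some, Option.some.injEq, Prod.mk.injEq, Fin.ext_iff]
        constructor
        · rintro ⟨h, h' | h'⟩
          · exact Or.inr ⟨by omega, h.symm, h'.symm⟩
          · exact Or.inl ⟨h.symm, by omega⟩
        · rintro (⟨h, h'⟩ | ⟨-, h, h'⟩)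
          · exact ⟨h.symm, Or.inr (by omega)⟩
          · exact ⟨h.symm, Or.inl h'.symm⟩
  obtain ⟨d, hd, hN⟩ := hdown
  split_ifs with h
  · have : (spider a b).neighborFinset (some (l, ⟨k, hk⟩)) = {d, some (l, ⟨k + 1, h⟩)} := by
      ext z
      rw [mem_neighborFinset, hN, Finset.mem_insert, Finset.mem_singleton, exists_prop_of_true h]
    rw [this, Finset.sum_pair, hd]
    · rfl
    · rintro rfl
      simp only [spiderHeight] at hd
      omega
  · have : (spider a b).neighborFinset (some (l, ⟨k, hk⟩)) = {d} := by
      ext z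
      rw [mem_neighborFinset, hN, Finset.mem_singleton]
      exact or_iff_left fun ⟨h', _⟩ => h h'
    rw [this, Finset.sum_singleton, hd, add_zero]

open Classical in
theorem degree_spider_some {a b : ℕ} (l : Fin b) (k : Fin a) :
    ((spider a b).degree (some (l, k)) : ℝ) = 1 + if (k : ℕ) + 1 < a then 1 else 0 := by
  rw [← sum_neighborFinset_spider_some (fun _ => 1), Finset.sum_const, nsmul_eq_mul, mul_one,
    card_neighborFinset_eq_degree]

open Classical in
theorem neighborFinset_spider_none {a b : ℕ} (ha : 0 < a) :
    (spider a b).neighborFinset none =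
      Finset.univ.map ⟨fun l : Fin b => some (l, ⟨0, ha⟩), fun l l' h => by simpa using h⟩ := by
  ext z
  rw [mem_neighborFinset, Finset.mem_map]
  rcases z with _ | ⟨l, k⟩
  · simp
  · rw [spider_adj_none_some]
    constructor
    · intro h
      exact ⟨l, Finset.mem_univ l, congrArg (fun k => some (l, k)) (Fin.ext h.symm)⟩
    · rintro ⟨l', -, h⟩
      rw [← (Prod.mk.inj (Option.some.inj h)).2]

open Classical in
/-- The hitting time of the center of the spider. -/
theorem isPotential_spider (a b : ℕ) :
    (spider a b).IsPotential none (fun y => (spider a b).degree y)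
      (fun y => 2 * a * spiderHeight y - (spiderHeight y : ℝ) ^ 2) := by
  refine ⟨by simp [spiderHeight], ?_⟩
  rintro (_ | ⟨l, k⟩) hy
  · exact absurd rfl hy
  change _ = ((spider a b).degree (some (l, k)) : ℝ)
  rw [degree_spider_some]
  refine (sum_neighborFinset_spider_some (fun n => 2 * a * spiderHeight (some (l, k)) -
    (spiderHeight (some (l, k)) : ℝ) ^ 2 - (2 * a * n - (n : ℝ) ^ 2)) l k).trans ?_
  have : spiderHeight (some (l, k)) = (k : ℕ) + 1 := rfl
  rw [this]
  push_cast
  -- At an inner vertex the linear term drops out and the square gives 2. At the pendent vertex, of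
  -- height `a`, the slope `2 * a` makes the difference equal to the degree 1.
  split_ifs with h
  · ring
  · have : (a : ℝ) = k + 1 := by exact_mod_cast (by omega : a = (k : ℕ) + 1)
    rw [this]
    ring

open Classical in
-- Each of the `b` neighbours of the center has hitting time 2a - 1, so the Laplacian of the hitting
-- time at the center is -b(2a - 1). It also equals b - 2|E|.
theorem card_edgeFinset_spider {a b : ℕ} (ha : 0 < a) :
    ((spider a b).edgeFinset.card : ℝ) = b * a := by
  have h := (isPotential_spider a b).sum_neighborFinset_sub_self
  have hd : ((spider a b).degree none : ℝ) = b := by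
    rw [← card_neighborFinset_eq_degree, neighborFinset_spider_none ha, Finset.card_map]
    simp
  rw [sum_degree_eq, neighborFinset_spider_none ha, Finset.sum_map, hd] at h
  change ∑ l : Fin b, (2 * (a : ℝ) * (0 : ℕ) - ((0 : ℕ) : ℝ) ^ 2 -
    (2 * (a : ℝ) * (0 + 1 : ℕ) - ((0 + 1 : ℕ) : ℝ) ^ 2)) = _ at h
  rw [Finset.sum_const, Finset.card_univ, Fintype.card_fin, nsmul_eq_mul] at h
  push_cast at h
  linarith

open Classical in
-- Dividing by the total degree 2ab leaves a mean hitting time 2a²/3 - 1/6 that does not depend on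
-- `b`.
theorem sum_degree_mul_spider (a b : ℕ) :
    ∑ y, ((spider a b).degree y : ℝ) * (2 * a * spiderHeight y - (spiderHeight y : ℝ) ^ 2) =
      b * (2 * a * (2 / 3 * (a : ℝ) ^ 2 - 1 / 6)) := by
  have hleg : ∑ k : Fin a, (1 + if (k : ℕ) + 1 < a then (1 : ℝ) else 0) *
      (2 * a * ((k : ℝ) + 1) - ((k : ℝ) + 1) ^ 2) = 2 * a * (2 / 3 * (a : ℝ) ^ 2 - 1 / 6) := by
    rcases a with _ | a
    · simp
    rw [Fin.sum_univ_eq_sum_range (fun k => (1 + if k + 1 < a + 1 then (1 : ℝ) else 0) *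
      (2 * ((a + 1 : ℕ) : ℝ) * ((k : ℝ) + 1) - ((k : ℝ) + 1) ^ 2)) (a + 1), Finset.sum_range_succ]
    -- The leg now has `a + 1` vertices. The first `a` have degree 2 and are summed here; the
    -- pendent one, of degree 1, was split off.
    have h1 : ∀ n : ℕ, n ≤ a → ∑ k ∈ Finset.range n, (1 + if k + 1 < a + 1 then (1 : ℝ) else 0) *
        (2 * ((a + 1 : ℕ) : ℝ) * ((k : ℝ) + 1) - ((k : ℝ) + 1) ^ 2) =
        2 * ((a : ℝ) + 1) * n * (n + 1) - (n : ℝ) * (n + 1) * (2 * n + 1) / 3 := by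
      intro n
      induction n with
      | zero => simp
      | succ n ih =>
        intro hn
        rw [Finset.sum_range_succ, ih (by omega), if_pos (by omega)]
        push_cast
        ring
    rw [h1 a le_rfl, if_neg (by omega)]
    push_cast
    ring
  rw [Fintype.sum_option, Fintype.sum_prod_type]
  simp only [spiderHeight, degree_spider_some]
  push_cast
  simp only [hleg, Finset.sum_const, Finset.card_univ, Fintype.card_fin, nsmul_eq_mul]
  ring

/-- `spiderPath` as an embedding. -/
def spiderPathEmb {a b : ℕ} {c c' : Fin b} (hc : c ≠ c') :
    Fin (2 * a + 1) ↪ Option (Fin b × Fin a) :=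
  ⟨spiderPath c c', spiderPath_injective hc⟩

theorem spiderPath_center {a b : ℕ} (c c' : Fin b) :
    spiderPath c c' (⟨a, by omega⟩ : Fin (2 * a + 1)) = none := by
  simp [spiderPath]

theorem mem_range_spiderPath {a b : ℕ} {c c' : Fin b} {l : Fin b} (hl : l = c ∨ l = c')
    (k : Fin a) : some (l, k) ∈ Set.range (spiderPath (a := a) c c') := by
  obtain ⟨k, hk⟩ := k
  rcases hl with rfl | rfl
  · refine ⟨⟨a - 1 - k, by omega⟩, ?_⟩
    rw [spiderPath, dif_pos (show a - 1 - k < a by omega)]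
    simp only [Option.some.injEq, Prod.mk.injEq, Fin.mk.injEq, true_and]
    omega
  · refine ⟨⟨a + 1 + k, by omega⟩, ?_⟩
    rw [spiderPath, dif_neg (show ¬ a + 1 + k < a by omega),
      dif_neg (show ¬ a + 1 + k = a by omega)]
    simp only [Option.some.injEq, Prod.mk.injEq, Fin.mk.injEq, true_and]
    omega

theorem leg_of_spiderPath_eq {a b : ℕ} {c c' l : Fin b} {k : Fin a} {x : Fin (2 * a + 1)}
    (h : spiderPath c c' x = some (l, k)) : l = c ∨ l = c' := by
  unfold spiderPath at h
  split_ifs at h <;> simp_all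

/-- The spider is the union of the path through two legs and the spider formed by the
other legs. -/
theorem isOneSum_spider {a b n : ℕ} {c c' : Fin b} (hc : c ≠ c') (e : Fin n ↪ Fin b)
    (he : ∀ l, l ∈ Set.range e ↔ l ≠ c ∧ l ≠ c') :
    IsOneSum (spider a b) (pathGraph (2 * a + 1)) (spider a n) (spiderPathEmb hc)
      (e.prodMap (Function.Embedding.refl (Fin a))).optionMap ⟨a, by omega⟩ none := by
  have hroot : spiderPathEmb (a := a) hc ⟨a, by omega⟩ = none := spiderPath_center c c'
  have hleg : ∀ l : Fin b, (∀ k : Fin a, some (l, k) ∈ Set.range (spiderPathEmb (a := a) hc)) ∨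
      ∀ k : Fin a, some (l, k) ∈ Set.range
        (e.prodMap (Function.Embedding.refl (Fin a))).optionMap := by
    intro l
    by_cases hl : l = c ∨ l = c'
    · exact Or.inl (mem_range_spiderPath hl)
    · rw [not_or] at hl
      obtain ⟨l', rfl⟩ := (he l).mpr hl
      exact Or.inr fun k => ⟨some (l', k), rfl⟩
  have hq : ∀ y z, (spider a b).Adj ((e.prodMap (Function.Embedding.refl (Fin a))).optionMap y)
      ((e.prodMap (Function.Embedding.refl (Fin a))).optionMap z) ↔ (spider a n).Adj y z := by
    rintro (_ | ⟨l, k⟩) (_ | ⟨l', k'⟩)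
    · simp
    · simp [spider_adj_none_some]
    · simp [spider_adj_some_none]
    · simp [spider_adj_some_some]
  refine ⟨le_antisymm ?_ (sup_le ?_ ?_), hroot, ?_, ?_⟩
  · intro y z hyz
    have hex : (y ∈ Set.range (spiderPathEmb (a := a) hc) ∧
        z ∈ Set.range (spiderPathEmb (a := a) hc)) ∨
        (y ∈ Set.range (e.prodMap (Function.Embedding.refl (Fin a))).optionMap ∧
        z ∈ Set.range (e.prodMap (Function.Embedding.refl (Fin a))).optionMap) := by
      rcases y with _ | ⟨l, k⟩ <;> rcases z with _ | ⟨l', k'⟩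
      · exact absurd rfl hyz.ne
      · exact (hleg l').imp (fun h => ⟨⟨_, hroot⟩, h k'⟩) fun h => ⟨⟨none, rfl⟩, h k'⟩
      · exact (hleg l).imp (fun h => ⟨h k, ⟨_, hroot⟩⟩) fun h => ⟨h k, ⟨none, rfl⟩⟩
      · obtain ⟨rfl, -⟩ := spider_adj_some_some.mp hyz
        exact (hleg l).imp (fun h => ⟨h k, h k'⟩) fun h => ⟨h k, h k'⟩
    rcases hex with ⟨⟨y, rfl⟩, z, rfl⟩ | ⟨⟨y, rfl⟩, z, rfl⟩
    · exact Or.inl ((map_adj _ _ _ _).mpr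
        ⟨y, z, (spider_adj_spiderPath hc y z).mp hyz, rfl, rfl⟩)
    · exact Or.inr ((map_adj _ _ _ _).mpr ⟨y, z, (hq y z).mp hyz, rfl, rfl⟩)
  · intro y z hyz
    obtain ⟨y, z, h, rfl, rfl⟩ := (map_adj _ _ _ _).mp hyz
    exact (spider_adj_spiderPath hc y z).mpr h
  · intro y z hyz
    obtain ⟨y, z, h, rfl, rfl⟩ := (map_adj _ _ _ _).mp hyz
    exact (hq y z).mpr h
  · rintro (_ | ⟨l, k⟩)
    · exact Or.inl ⟨_, hroot⟩
    · exact (hleg l).imp (fun h => h k) fun h => h k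
  · rintro y (_ | ⟨l, k⟩) h
    · exact ⟨(spiderPathEmb hc).injective (h.trans hroot.symm), rfl⟩
    · have h1 := leg_of_spiderPath_eq (l := e l) (k := k) h
      have h2 := (he (e l)).mp ⟨l, rfl⟩
      exact absurd h1 (not_or.mpr h2)

theorem map_edge {V W : Type*} (p : V ↪ W) (i j : V) : (edge i j).map p = edge (p i) (p j) := by
  ext y z
  rw [map_adj]
  simp only [edge_adj]
  constructor
  · rintro ⟨y, z, ⟨h, hne⟩, rfl, rfl⟩
    refine ⟨?_, p.injective.ne hne⟩
    rcases h with ⟨rfl, rfl⟩ | ⟨rfl, rfl⟩ <;> simp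
  · rintro ⟨⟨rfl, rfl⟩ | ⟨rfl, rfl⟩, hne⟩
    · exact ⟨i, j, ⟨by simp, fun h => hne (by rw [h])⟩, rfl, rfl⟩
    · exact ⟨j, i, ⟨by simp, fun h => hne (by rw [h])⟩, rfl, rfl⟩

theorem IsOneSum.sup_edge {V V₁ V₂ : Type*} {G : SimpleGraph V} {G₁ : SimpleGraph V₁}
    {G₂ : SimpleGraph V₂} {p : V₁ ↪ V} {q : V₂ ↪ V} {v₁ : V₁} {v₂ : V₂}
    (h : IsOneSum G G₁ G₂ p q v₁ v₂) (i j : V₁) :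
    IsOneSum (G ⊔ edge (p i) (p j)) (G₁ ⊔ edge i j) G₂ p q v₁ v₂ where
  eq_sup := by
    have : (G₁ ⊔ edge i j).map p = G₁.map p ⊔ edge (p i) (p j) := by
      rw [← map_edge]
      ext y z
      simp only [map_adj, sup_adj]
      constructor
      · rintro ⟨y, z, h | h, rfl, rfl⟩
        · exact Or.inl ⟨y, z, h, rfl, rfl⟩
        · exact Or.inr ⟨y, z, h, rfl, rfl⟩
      · rintro (⟨y, z, h, rfl, rfl⟩ | ⟨y, z, h, rfl, rfl⟩)
        · exact ⟨y, z, Or.inl h, rfl, rfl⟩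
        · exact ⟨y, z, Or.inr h, rfl, rfl⟩
    rw [this, h.eq_sup, sup_right_comm]
  root := h.root
  cover := h.cover
  eq_root := h.eq_root

/-! ### The path, and the path with an additional edge -/

open Classical in
theorem sum_neighborFinset_pathGraph {n : ℕ} (F : ℕ → ℝ) (y : Fin n) :
    ∑ z ∈ (pathGraph n).neighborFinset y, F z =
      (if 0 < (y : ℕ) then F (y - 1) else 0) + if (y : ℕ) + 1 < n then F (y + 1) else 0 := by
  have h : ∀ z : Fin n, (if (pathGraph n).Adj y z then F z else 0) =
      (if (z : ℕ) = y - 1 ∧ 0 < (y : ℕ) then F z else 0) +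
        if (z : ℕ) = y + 1 then F z else 0 := by
    intro z
    rw [pathGraph_adj]
    split_ifs <;> first | omega | simp
  rw [neighborFinset_eq_filter, Finset.sum_filter, Finset.sum_congr rfl fun z _ => h z,
    Finset.sum_add_distrib,
    Fin.sum_univ_eq_sum_range (fun z => if z = (y : ℕ) - 1 ∧ 0 < (y : ℕ) then F z else 0) n,
    Fin.sum_univ_eq_sum_range (fun z => if z = (y : ℕ) + 1 then F z else 0) n]
  congr 1
  · split_ifs with hy
    · simp only [hy, and_true, Finset.sum_ite_eq', Finset.mem_range]
      rw [if_pos (by omega)]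
    · simp [hy]
  · simp [Finset.sum_ite_eq']

open Classical in
theorem degree_pathGraph {n : ℕ} (y : Fin n) : ((pathGraph n).degree y : ℝ) =
    (if 0 < (y : ℕ) then 1 else 0) + if (y : ℕ) + 1 < n then 1 else 0 := by
  rw [← sum_neighborFinset_pathGraph (fun _ => 1), Finset.sum_const, nsmul_eq_mul, mul_one,
    card_neighborFinset_eq_degree]

open Classical in
theorem sum_degree_mul_pathGraph {n : ℕ} (F : ℕ → ℝ) :
    ∑ y, ((pathGraph (n + 1)).degree y : ℝ) * F y = ∑ k ∈ Finset.range n, (F k + F (k + 1)) := by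
  simp_rw [degree_pathGraph, add_mul, ite_mul, one_mul, zero_mul]
  rw [Finset.sum_add_distrib,
    Fin.sum_univ_eq_sum_range (fun y => if 0 < y then F y else 0) (n + 1),
    Fin.sum_univ_eq_sum_range (fun y => if y + 1 < n + 1 then F y else 0) (n + 1),
    Finset.sum_range_succ', Finset.sum_range_succ, Finset.sum_add_distrib, add_comm]
  congr 1
  · simp only [lt_irrefl, if_false, add_zero]
    exact Finset.sum_congr rfl fun k hk => if_pos (by simpa using hk)
  · simp

/-- Laplacian of the distance to a vertex of a path. -/
theorem laplacian_abs_sub (n x y : ℕ) (hn : 0 < n) (hx : x < n + 1) (hy : y < n + 1) :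
    ((if 0 < y then |(y : ℝ) - x| - |((y - 1 : ℕ) : ℝ) - x| else 0) +
      if y + 1 < n + 1 then |(y : ℝ) - x| - |((y + 1 : ℕ) : ℝ) - x| else 0) =
      (if y = 0 then 1 else 0) + (if y = n then 1 else 0) - 2 * if y = x then 1 else 0 := by
  have key : ∀ k : ℕ, |((k + 1 : ℕ) : ℝ) - x| - |(k : ℝ) - x| = if x ≤ k then 1 else -1 := by
    intro k
    split_ifs with h
    · have : (x : ℝ) ≤ k := by exact_mod_cast h
      rw [abs_of_nonneg (by push_cast; linarith), abs_of_nonneg (by linarith)]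
      push_cast; ring
    · have : (k : ℝ) + 1 ≤ x := by exact_mod_cast (by omega : k + 1 ≤ x)
      rw [abs_of_nonpos (by push_cast; linarith), abs_of_nonpos (by linarith)]
      push_cast; ring
  have k1 : |(y : ℝ) - x| - |((y + 1 : ℕ) : ℝ) - x| = - if x ≤ y then 1 else -1 := by
    rw [← key y]; ring
  rw [k1]
  rcases y with _ | y
  · split_ifs <;> first | omega | norm_num
  · rw [Nat.add_sub_cancel, key y, if_neg (Nat.succ_ne_zero y)]
    split_ifs <;> first | omega | norm_num

open Classical in
theorem sum_neighborFinset_abs_sub {n : ℕ} (hn : 0 < n) (x y : Fin (n + 1)) :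
    ∑ z ∈ (pathGraph (n + 1)).neighborFinset y, (|(y : ℝ) - x| - |(z : ℝ) - x|) =
      (if (y : ℕ) = 0 then 1 else 0) + (if (y : ℕ) = n then 1 else 0) -
        2 * if y = x then 1 else 0 := by
  rw [sum_neighborFinset_pathGraph (fun z => |(y : ℝ) - x| - |(z : ℝ) - x|),
    laplacian_abs_sub n x y hn x.2 y.2]
  simp only [Fin.ext_iff]

/-- The Green function of the path grounded at `v`. -/
noncomputable def pathGreen {n : ℕ} (v x y : Fin n) : ℝ :=
  (|(x : ℝ) - v| + |(y : ℝ) - v| - |(y : ℝ) - x|) / 2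

theorem pathGreen_comm {n : ℕ} (v x y : Fin n) : pathGreen v x y = pathGreen v y x := by
  rw [pathGreen, pathGreen, abs_sub_comm (x : ℝ) (y : ℝ)]
  ring

theorem pathGreen_self {n : ℕ} (v x : Fin n) : pathGreen v x x = |(x : ℝ) - v| := by
  simp [pathGreen]

open Classical in
-- `pathGreen` is the Gromov product of `x` and `y` based at `v`. The Laplacian of the distance to a
-- vertex has end terms independent of that vertex, so they cancel in the difference of two
-- distances.
theorem sum_neighborFinset_pathGreen {n : ℕ} (hn : 0 < n) (v x y : Fin (n + 1)) :
    ∑ z ∈ (pathGraph (n + 1)).neighborFinset y, (pathGreen v x y - pathGreen v x z) =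
      (if y = x then 1 else 0) - if y = v then 1 else 0 := by
  have h : ∀ z, pathGreen v x y - pathGreen v x z =
      ((|(y : ℝ) - v| - |(z : ℝ) - v|) - (|(y : ℝ) - x| - |(z : ℝ) - x|)) / 2 := by
    intro z; rw [pathGreen, pathGreen]; ring
  simp_rw [h]
  rw [← Finset.sum_div, Finset.sum_sub_distrib, sum_neighborFinset_abs_sub hn,
    sum_neighborFinset_abs_sub hn]
  ring

open Classical in
theorem isPotential_pathGreen {n : ℕ} (hn : 0 < n) (v x : Fin (n + 1)) :
    (pathGraph (n + 1)).IsPotential v (fun y => if y = x then 1 else 0) (pathGreen v x) := by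
  refine ⟨?_, fun y hy => ?_⟩
  · rw [pathGreen, abs_sub_comm]; simp
  · rw [sum_neighborFinset_pathGreen hn, if_neg hy, sub_zero]

/-- The hitting time of the central vertex of a path. -/
noncomputable def pathHitting (a : ℕ) (y : ℝ) : ℝ := 2 * a * |y - a| - (y - a) ^ 2

open Classical in
-- This is the function 2ah - h² of the spider with h = |y - a|, the path being two legs of length
-- `a`.
theorem isPotential_pathHitting {a : ℕ} (ha : 0 < a) :
    (pathGraph (2 * a + 1)).IsPotential ⟨a, by omega⟩ (fun y => (pathGraph (2 * a + 1)).degree y)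
      (fun y => pathHitting a y) := by
  refine ⟨by simp [pathHitting], fun y hy => ?_⟩
  have h : ∀ z : Fin (2 * a + 1), pathHitting a y - pathHitting a z =
      2 * a * (|(y : ℝ) - a| - |(z : ℝ) - a|) -
      (((y : ℝ) - a) ^ 2 - ((z : ℝ) - a) ^ 2) := by
    intro z; rw [pathHitting, pathHitting]; ring
  have habs := sum_neighborFinset_abs_sub (n := 2 * a) (by omega) ⟨a, by omega⟩ y
  simp_rw [h]
  rw [Finset.sum_sub_distrib, ← Finset.mul_sum, habs, if_neg hy, degree_pathGraph,
    sum_neighborFinset_pathGraph (fun z => ((y : ℝ) - a) ^ 2 - ((z : ℝ) - a) ^ 2)]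
  obtain ⟨y, hy'⟩ := y
  simp only
  rcases y with _ | y
  · have h0 : ¬ 0 = 2 * a := by omega
    have h1 : 0 + 1 < 2 * a + 1 := by omega
    simp only [h0, h1, lt_irrefl, if_true, if_false]
    push_cast
    ring
  · have h0 : ¬ y + 1 = 0 := by omega
    have h1 : 0 < y + 1 := by omega
    by_cases h2 : y + 1 = 2 * a
    · have h3 : ¬ y + 1 + 1 < 2 * a + 1 := by omega
      have : (y : ℝ) = 2 * a - 1 := by
        rw [eq_sub_iff_add_eq]; exact_mod_cast h2
      simp only [h0, h1, h3, if_true, if_false, Nat.add_sub_cancel, if_pos h2]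
      push_cast
      rw [this]
      ring
    · have h3 : y + 1 + 1 < 2 * a + 1 := by omega
      simp only [h0, h1, h2, h3, if_true, if_false, Nat.add_sub_cancel]
      push_cast
      ring

/-! ### Adding an edge: rank-one update of the Green function -/

open Classical in
theorem sum_neighborFinset_sup_edge {V : Type*} [Fintype V] [DecidableEq V] {G : SimpleGraph V} {i j : V}
    (hij : i ≠ j) (hG : ¬ G.Adj i j) {G' : SimpleGraph V}
    (hG' : G' = G ⊔ edge i j) (f : V → ℝ) (y : V) :
    ∑ z ∈ G'.neighborFinset y, f z =
      ∑ z ∈ G.neighborFinset y, f z + (if y = i then f j else 0) + if y = j then f i else 0 := by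
  have h : ∀ z, (if G'.Adj y z then f z else 0) =
      (if G.Adj y z then f z else 0) + (if z = j then (if y = i then f z else 0) else 0) +
        if z = i then (if y = j then f z else 0) else 0 := by
    intro z
    have hji : ¬ G.Adj j i := fun h => hG h.symm
    simp only [hG', sup_adj, edge_adj]
    by_cases h1 : y = i
    · subst h1
      by_cases h2 : z = j
      · subst h2; simp [hG, hij, hij.symm]
      · by_cases h3 : z = y <;> simp [h2, hij, h3]
    · by_cases h2 : y = j
      · subst h2
        by_cases h3 : z = i
        · subst h3; simp [hji, hij, hij.symm]
        · simp [h3, h1]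
      · simp [h1, h2]
  rw [neighborFinset_eq_filter, neighborFinset_eq_filter, Finset.sum_filter, Finset.sum_filter,
    Finset.sum_congr rfl fun z _ => h z, Finset.sum_add_distrib, Finset.sum_add_distrib]
  simp

open Classical in
theorem degree_sup_edge {V : Type*} [Fintype V] [DecidableEq V] {G : SimpleGraph V} {i j : V}
    (hij : i ≠ j) (hG : ¬ G.Adj i j) {G' : SimpleGraph V}
    (hG' : G' = G ⊔ edge i j) (y : V) :
    (G'.degree y : ℝ) =
      G.degree y + (if y = i then 1 else 0) + if y = j then 1 else 0 := by
  have := sum_neighborFinset_sup_edge hij hG hG' (fun _ => (1 : ℝ)) y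
  rwa [Finset.sum_const, Finset.sum_const, nsmul_eq_mul, nsmul_eq_mul, mul_one, mul_one,
    card_neighborFinset_eq_degree, card_neighborFinset_eq_degree] at this

open Classical in
theorem sum_degree_mul_sup_edge {V : Type*} [Fintype V] [DecidableEq V] {G : SimpleGraph V} {i j : V}
    (hij : i ≠ j) (hG : ¬ G.Adj i j) {G' : SimpleGraph V}
    (hG' : G' = G ⊔ edge i j) (f : V → ℝ) :
    ∑ y, (G'.degree y : ℝ) * f y = ∑ y, (G.degree y : ℝ) * f y + f i + f j := by
  simp_rw [degree_sup_edge hij hG hG', add_mul, Finset.sum_add_distrib]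
  simp

/-- Half the difference of the distances to `i` and `j`, normalised to vanish at `v`. -/
noncomputable def pathDrop {n : ℕ} (v i j y : Fin n) : ℝ :=
  (|(y : ℝ) - i| - |(y : ℝ) - j| - (|(v : ℝ) - i| - |(v : ℝ) - j|)) / 2

/-- The Green function of the path with the additional edge `{i, j}`, grounded at `v`. -/
noncomputable def pathEdgeGreen {n : ℕ} (v i j x y : Fin n) : ℝ :=
  pathGreen v x y - pathDrop v i j x * pathDrop v i j y / ((j : ℝ) - i + 1)

open Classical in
theorem sum_neighborFinset_pathDrop {n : ℕ} (hn : 0 < n) (v i j y : Fin (n + 1)) :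
    ∑ z ∈ (pathGraph (n + 1)).neighborFinset y, (pathDrop v i j y - pathDrop v i j z) =
      (if y = j then 1 else 0) - if y = i then 1 else 0 := by
  have h : ∀ z, pathDrop v i j y - pathDrop v i j z =
      ((|(y : ℝ) - i| - |(z : ℝ) - i|) - (|(y : ℝ) - j| - |(z : ℝ) - j|)) / 2 := by
    intro z; rw [pathDrop, pathDrop]; ring
  simp_rw [h]
  rw [← Finset.sum_div, Finset.sum_sub_distrib, sum_neighborFinset_abs_sub hn,
    sum_neighborFinset_abs_sub hn]
  ring

theorem pathGreen_sub_pathGreen {n : ℕ} (v i j x : Fin n) :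
    pathGreen v x j - pathGreen v x i = pathDrop v i j x := by
  rw [pathGreen, pathGreen, pathDrop, abs_sub_comm (j : ℝ) x, abs_sub_comm (i : ℝ) x,
    abs_sub_comm (j : ℝ) v, abs_sub_comm (i : ℝ) v]
  ring

theorem pathDrop_sub_pathDrop {n : ℕ} (v : Fin n) {i j : Fin n} (hij : i < j) :
    pathDrop v i j j - pathDrop v i j i = (j : ℝ) - i := by
  have : (i : ℝ) < j := by exact_mod_cast hij
  rw [pathDrop, pathDrop, abs_sub_comm (i : ℝ) j, abs_of_pos (by linarith : (0 : ℝ) < j - i)]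
  simp
  ring

theorem not_adj_pathGraph {n : ℕ} {i j : Fin n} (hij : (i : ℕ) + 2 ≤ j) :
    ¬ (pathGraph n).Adj i j := by
  rw [pathGraph_adj]
  omega

open Classical in
-- Sherman–Morrison: the new edge adds wwᵀ to the Laplacian, w = e_i - e_j. Up to sign, the old
-- Green function maps w to `pathDrop`, and its quadratic form at w is j - i, whence the denominator
-- 1 + (j - i).
theorem isPotential_pathEdgeGreen {n : ℕ} {i j : Fin (n + 1)} (hij : (i : ℕ) + 2 ≤ j)
    (v x : Fin (n + 1)) :
    (pathGraph (n + 1) ⊔ edge i j).IsPotential v (fun y => if y = x then 1 else 0)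
      (pathEdgeGreen v i j x) := by
  have hlt : i < j := by rw [Fin.lt_def]; omega
  have hℓ : (j : ℝ) - i + 1 ≠ 0 := by
    have : (i : ℝ) < j := by exact_mod_cast hlt
    linarith
  have hn : 0 < n := by omega
  refine ⟨?_, fun y hy => ?_⟩
  · rw [pathEdgeGreen, (isPotential_pathGreen hn v x).1]
    simp [pathDrop]
  · refine (sum_neighborFinset_sup_edge hlt.ne (not_adj_pathGraph hij) rfl
      (fun z => pathEdgeGreen v i j x y - pathEdgeGreen v i j x z) y).trans ?_
    have h : ∀ y z, pathEdgeGreen v i j x y - pathEdgeGreen v i j x z =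
        (pathGreen v x y - pathGreen v x z) - pathDrop v i j x / ((j : ℝ) - i + 1) *
          (pathDrop v i j y - pathDrop v i j z) := by
      intro y z; rw [pathEdgeGreen, pathEdgeGreen]; ring
    -- The drop D across the new edge becomes D - D(j - i)/(j - i + 1) = D/(j - i + 1); the
    -- resulting current through the edge cancels the Laplacian of the correction term.
    have hd : pathEdgeGreen v i j x j - pathEdgeGreen v i j x i =
        pathDrop v i j x / ((j : ℝ) - i + 1) := by
      rw [h, pathGreen_sub_pathGreen, pathDrop_sub_pathDrop v hlt]
      field_simp
      ring
    have e1 : (if y = i then pathEdgeGreen v i j x y - pathEdgeGreen v i j x j else 0) =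
        - (pathDrop v i j x / ((j : ℝ) - i + 1)) * if y = i then 1 else 0 := by
      split_ifs with h'
      · subst h'; linarith
      · simp
    have e2 : (if y = j then pathEdgeGreen v i j x y - pathEdgeGreen v i j x i else 0) =
        (pathDrop v i j x / ((j : ℝ) - i + 1)) * if y = j then 1 else 0 := by
      split_ifs with h'
      · subst h'; linarith
      · simp
    rw [e1, e2]
    simp_rw [h]
    rw [Finset.sum_sub_distrib, ← Finset.mul_sum, sum_neighborFinset_pathGreen hn,
      sum_neighborFinset_pathDrop hn, if_neg hy]
    ring

/-! ### Moments and hitting times of the path with an additional edge -/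

/-- A degree-weighted sum on a path is a sum of `F k + F (k + 1)` over its edges, so an
antidifference `Φ` evaluates it. -/
theorem sum_range_add_succ_eq {F Φ : ℕ → ℝ} (h : ∀ k, F k + F (k + 1) = Φ (k + 1) - Φ k) (n : ℕ) :
    ∑ k ∈ Finset.range n, (F k + F (k + 1)) = Φ n - Φ 0 := by
  simp_rw [h]
  exact Finset.sum_range_sub Φ n

open Classical in
theorem sum_degree_mul_abs_sub {n : ℕ} (x : Fin (n + 1)) :
    ∑ y, ((pathGraph (n + 1)).degree y : ℝ) * |(y : ℝ) - x| =
      ((n : ℝ) - x) ^ 2 + (x : ℝ) ^ 2 := by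
  rw [sum_degree_mul_pathGraph fun y => |(y : ℝ) - x|,
    sum_range_add_succ_eq (Φ := fun k => ((k : ℝ) - x) * |(k : ℝ) - x|)]
  · have : (x : ℝ) ≤ n := by exact_mod_cast Nat.lt_succ_iff.mp x.2
    rw [abs_of_nonneg (by linarith), Nat.cast_zero, zero_sub, abs_neg,
      abs_of_nonneg (Nat.cast_nonneg _)]
    ring
  · intro k
    rcases le_or_gt (x : ℕ) k with h | h
    · have : (x : ℝ) ≤ k := by exact_mod_cast h
      rw [abs_of_nonneg (by linarith), abs_of_nonneg (by push_cast; linarith)]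
      push_cast; ring
    · have : (k : ℝ) + 1 ≤ x := by exact_mod_cast h
      rw [abs_of_nonpos (by linarith), abs_of_nonpos (by push_cast; linarith)]
      push_cast; ring

open Classical in
theorem sum_degree_pathGraph (n : ℕ) : ∑ y, ((pathGraph (n + 1)).degree y : ℝ) = 2 * n := by
  have := sum_degree_mul_pathGraph (n := n) fun _ => 1
  simp only [mul_one] at this
  rw [this]
  simp only [Finset.sum_const, Finset.card_range, nsmul_eq_mul]
  ring

open Classical in
theorem sum_degree_mul_pathHitting (a : ℕ) :
    ∑ y, ((pathGraph (2 * a + 1)).degree y : ℝ) * pathHitting a y =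
      4 * a * (2 / 3 * (a : ℝ) ^ 2 - 1 / 6) := by
  have h1 := sum_degree_mul_abs_sub (n := 2 * a) ⟨a, by omega⟩
  have h2 : ∑ y, ((pathGraph (2 * a + 1)).degree y : ℝ) * ((y : ℝ) - a) ^ 2 =
      2 * a * (2 * (a : ℝ) ^ 2 + 1) / 3 := by
    rw [sum_degree_mul_pathGraph fun y => ((y : ℝ) - a) ^ 2,
      sum_range_add_succ_eq (Φ := fun k => ((k : ℝ) - a) * (2 * ((k : ℝ) - a) ^ 2 + 1) / 3)]
    · push_cast; ring
    · intro k; push_cast; ring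
  have h3 : ∀ y : Fin (2 * a + 1), ((pathGraph (2 * a + 1)).degree y : ℝ) * pathHitting a y =
      2 * a * (((pathGraph (2 * a + 1)).degree y : ℝ) * |(y : ℝ) - a|) -
        ((pathGraph (2 * a + 1)).degree y : ℝ) * ((y : ℝ) - a) ^ 2 := by
    intro y; rw [pathHitting]; ring
  rw [Finset.sum_congr rfl fun y _ => h3 y, Finset.sum_sub_distrib, ← Finset.mul_sum, h2]
  simp only at h1
  rw [h1]
  push_cast
  ring

/-- The distance from `i` to the projection of `y` to the interval from `i` to `j`. -/
noncomputable def clampDist (i j y : ℝ) : ℝ := (j - i + |y - i| - |y - j|) / 2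

theorem pathDrop_eq {n : ℕ} (v i j y : Fin n) :
    pathDrop v i j y = clampDist i j y - clampDist i j v := by
  rw [pathDrop, clampDist, clampDist]
  ring

open Classical in
theorem sum_degree_mul_clampDist {n : ℕ} (i j : Fin (n + 1)) :
    ∑ y, ((pathGraph (n + 1)).degree y : ℝ) * clampDist i j y =
      ((j : ℝ) - i) ^ 2 + 2 * ((j : ℝ) - i) * (n - j) := by
  have h : ∀ y : Fin (n + 1), ((pathGraph (n + 1)).degree y : ℝ) * clampDist i j y =
      ((j : ℝ) - i) / 2 * ((pathGraph (n + 1)).degree y : ℝ) +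
      (1 / 2) * (((pathGraph (n + 1)).degree y : ℝ) * |(y : ℝ) - i|) -
      (1 / 2) * (((pathGraph (n + 1)).degree y : ℝ) * |(y : ℝ) - j|) := by
    intro y; rw [clampDist]; ring
  rw [Finset.sum_congr rfl fun y _ => h y, Finset.sum_sub_distrib, Finset.sum_add_distrib,
    ← Finset.mul_sum, ← Finset.mul_sum, ← Finset.mul_sum, sum_degree_mul_abs_sub,
    sum_degree_mul_abs_sub, sum_degree_pathGraph]
  ring

open Classical in
theorem sum_degree_mul_clampDist_sq {n : ℕ} {i j : Fin (n + 1)} (hij : i < j) :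
    ∑ y, ((pathGraph (n + 1)).degree y : ℝ) * clampDist i j y ^ 2 =
      ((j : ℝ) - i) * (2 * ((j : ℝ) - i) ^ 2 + 1) / 3 + 2 * ((j : ℝ) - i) ^ 2 * (n - j) := by
  have hij' : (i : ℝ) < j := by exact_mod_cast hij
  rw [sum_degree_mul_pathGraph fun y => clampDist i j y ^ 2,
    -- The first term of `Φ` does the work between `i` and `j` and is constant elsewhere. The second
    -- vanishes up to `j` and grows by 2(j - i)² per step beyond it.
    sum_range_add_succ_eq (Φ := fun k => clampDist i j k * (2 * clampDist i j k ^ 2 + 1) / 3 +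
      ((j : ℝ) - i) ^ 2 * ((k : ℝ) - j + |(k : ℝ) - j|))]
  · have h1 : (j : ℝ) ≤ n := by exact_mod_cast Nat.lt_succ_iff.mp j.2
    have h2 : (0 : ℝ) ≤ i := Nat.cast_nonneg _
    simp only [clampDist, Nat.cast_zero, zero_sub, abs_neg]
    rw [abs_of_nonneg (by linarith : (0 : ℝ) ≤ n - i), abs_of_nonneg (by linarith : (0 : ℝ) ≤ n - j),
      abs_of_nonneg h2, abs_of_nonneg (by linarith : (0 : ℝ) ≤ j)]
    ring
  · intro k
    simp only [clampDist]
    push_cast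
    rcases lt_or_ge k i with h | h
    · have h' : (k : ℝ) + 1 ≤ i := by exact_mod_cast h
      rw [abs_of_nonpos (by linarith : (k : ℝ) - i ≤ 0), abs_of_nonpos (by linarith : (k : ℝ) - j ≤ 0),
        abs_of_nonpos (by linarith : (k : ℝ) + 1 - i ≤ 0),
        abs_of_nonpos (by linarith : (k : ℝ) + 1 - j ≤ 0)]
      ring
    · have h' : (i : ℝ) ≤ k := by exact_mod_cast h
      rw [abs_of_nonneg (by linarith : 0 ≤ (k : ℝ) - i),
        abs_of_nonneg (by linarith : 0 ≤ (k : ℝ) + 1 - i)]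
      rcases lt_or_ge k j with h2 | h2
      · have h2' : (k : ℝ) + 1 ≤ j := by exact_mod_cast h2
        rw [abs_of_nonpos (by linarith : (k : ℝ) - j ≤ 0),
          abs_of_nonpos (by linarith : (k : ℝ) + 1 - j ≤ 0)]
        ring
      · have h2' : (j : ℝ) ≤ k := by exact_mod_cast h2
        rw [abs_of_nonneg (by linarith : 0 ≤ (k : ℝ) - j),
          abs_of_nonneg (by linarith : 0 ≤ (k : ℝ) + 1 - j)]
        ring

open Classical in
theorem isPotential_sum_degree_mul {V : Type*} [Fintype V] [DecidableEq V] {G : SimpleGraph V}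
    {v : V} {u : V → V → ℝ}
    (hu : ∀ x, G.IsPotential v (fun y => if y = x then 1 else 0) (u x)) :
    G.IsPotential v (fun y => G.degree y) (fun y => ∑ x, (G.degree x : ℝ) * u x y) :=
  (IsPotential.sum hu fun x => (G.degree x : ℝ)).congr fun y _ => by simp

theorem connected_pathGraph_sup_edge {n : ℕ} (i j : Fin (n + 1)) :
    (pathGraph (n + 1) ⊔ edge i j).Connected :=
  (pathGraph_connected n).mono le_sup_left

theorem moment_pathGraph {a : ℕ} (ha : 0 < a) :
    (pathGraph (2 * a + 1)).moment ⟨a, by omega⟩ = 2 * (a : ℝ) ^ 2 := by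
  classical
  rw [(pathGraph_connected (2 * a)).moment_eq (isPotential_pathGreen (by omega) _)]
  simp_rw [pathGreen_self]
  refine Eq.trans ?_ ((sum_degree_mul_abs_sub (n := 2 * a) ⟨a, by omega⟩).trans ?_)
  · congr!
  · push_cast; ring

/-- The change of the moment of the central vertex of a path caused by the edge `{i, j}`. -/
noncomputable def momentGain (a i j : ℝ) : ℝ :=
  |i - a| + |j - a| - ((j - i) * (2 * (j - i) ^ 2 + 1) / 3 + 2 * (j - i) ^ 2 * (2 * a - j) +
    (j - i) ^ 2 - 2 * clampDist i j a * ((j - i) ^ 2 + 2 * (j - i) * (2 * a - j) + (j - i)) +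
    (4 * a + 2) * clampDist i j a ^ 2) / (j - i + 1)

/-- The degree-weighted sum of the hitting times of the central vertex in the path with the
additional edge `{i, j}`. -/
noncomputable def hittingSum (a i j : ℝ) : ℝ :=
  4 * a * (2 / 3 * a ^ 2 - 1 / 6) + 2 * (2 * a * |i - a| - (i - a) ^ 2) +
    2 * (2 * a * |j - a| - (j - a) ^ 2) + 2 * (|i - a| + |j - a|) - (j - i) -
    ((j - i) ^ 2 + 2 * (j - i) * (2 * a - j) + (j - i) - (4 * a + 2) * clampDist i j a) ^ 2 /
      (j - i + 1)

theorem clampDist_left {i j : ℝ} (h : i ≤ j) : clampDist i j i = 0 := by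
  rw [clampDist, abs_sub_comm i j, abs_of_nonneg (by linarith : 0 ≤ j - i)]
  simp

theorem clampDist_right {i j : ℝ} (h : i ≤ j) : clampDist i j j = j - i := by
  rw [clampDist, abs_of_nonneg (by linarith : 0 ≤ j - i)]
  simp

open Classical in
theorem sum_degree_sup_edge {n : ℕ} {i j : Fin (n + 1)} (hij : (i : ℕ) + 2 ≤ j)
    {G : SimpleGraph (Fin (n + 1))} (hG : G = pathGraph (n + 1) ⊔ edge i j) :
    ∑ y, (G.degree y : ℝ) = 2 * n + 2 := by
  have := sum_degree_mul_sup_edge (G := pathGraph (n + 1)) (i := i) (j := j)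
    (by rw [Ne, Fin.ext_iff]; omega) (not_adj_pathGraph hij) hG fun _ => 1
  simp only [mul_one, sum_degree_pathGraph] at this
  rw [this]
  ring

open Classical in
theorem sum_degree_mul_pathDrop {n : ℕ} {v i j : Fin (n + 1)} (hij : (i : ℕ) + 2 ≤ j)
    {G : SimpleGraph (Fin (n + 1))} (hG : G = pathGraph (n + 1) ⊔ edge i j) :
    ∑ y, (G.degree y : ℝ) * pathDrop v i j y =
      ((j : ℝ) - i) ^ 2 + 2 * ((j : ℝ) - i) * (n - j) + (j - i) -
        (2 * n + 2) * clampDist i j v := by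
  have hlt : i < j := by rw [Fin.lt_def]; omega
  have hlt' : (i : ℝ) ≤ j := by exact_mod_cast hlt.le
  simp_rw [pathDrop_eq, mul_sub, Finset.sum_sub_distrib]
  rw [← Finset.sum_mul, sum_degree_sup_edge hij hG,
    sum_degree_mul_sup_edge hlt.ne (not_adj_pathGraph hij) hG fun y : Fin (n + 1) =>
      clampDist i j y, sum_degree_mul_clampDist, clampDist_left hlt', clampDist_right hlt']
  ring

open Classical in
theorem sum_degree_mul_pathDrop_sq {n : ℕ} {v i j : Fin (n + 1)} (hij : (i : ℕ) + 2 ≤ j)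
    {G : SimpleGraph (Fin (n + 1))} (hG : G = pathGraph (n + 1) ⊔ edge i j) :
    ∑ y, (G.degree y : ℝ) * pathDrop v i j y ^ 2 =
      ((j : ℝ) - i) * (2 * ((j : ℝ) - i) ^ 2 + 1) / 3 + 2 * ((j : ℝ) - i) ^ 2 * (n - j) +
        ((j : ℝ) - i) ^ 2 - 2 * clampDist i j v *
          (((j : ℝ) - i) ^ 2 + 2 * ((j : ℝ) - i) * (n - j) + (j - i)) +
        (2 * n + 2) * clampDist i j v ^ 2 := by
  have hlt : i < j := by rw [Fin.lt_def]; omega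
  have hlt' : (i : ℝ) ≤ j := by exact_mod_cast hlt.le
  have h : ∀ y, (G.degree y : ℝ) * pathDrop v i j y ^ 2 =
      (G.degree y : ℝ) * clampDist i j y ^ 2 -
      2 * clampDist i j v *
        ((G.degree y : ℝ) * pathDrop v i j y) -
      (G.degree y : ℝ) * clampDist i j v ^ 2 := by
    intro y; rw [pathDrop_eq]; ring
  rw [Finset.sum_congr rfl fun y _ => h y, Finset.sum_sub_distrib, Finset.sum_sub_distrib,
    ← Finset.mul_sum, ← Finset.sum_mul, sum_degree_sup_edge hij hG, sum_degree_mul_pathDrop hij hG,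
    sum_degree_mul_sup_edge hlt.ne (not_adj_pathGraph hij) hG fun y : Fin (n + 1) =>
      clampDist i j y ^ 2, sum_degree_mul_clampDist_sq hlt, clampDist_left hlt',
    clampDist_right hlt']
  ring

/-- The updated Green function has diagonal |x - a| - D(x)²/(j - i + 1) with D = `pathDrop`. The
raised degrees of `i` and `j` account for the terms |i - a| + |j - a|. -/
theorem moment_pathGraph_sup_edge {a : ℕ} {i j : Fin (2 * a + 1)} (hij : (i : ℕ) + 2 ≤ j)
    {G : SimpleGraph (Fin (2 * a + 1))} (hG : G = pathGraph (2 * a + 1) ⊔ edge i j) :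
    G.moment ⟨a, by omega⟩ = 2 * (a : ℝ) ^ 2 + momentGain a i j := by
  classical
  have hne : i ≠ j := by rw [Ne, Fin.ext_iff]; omega
  have hconn : G.Connected := hG ▸ connected_pathGraph_sup_edge i j
  rw [hconn.moment_eq (hG ▸ isPotential_pathEdgeGreen hij _)]
  have h : ∀ x, pathEdgeGreen ⟨a, by omega⟩ i j x x = |(x : ℝ) - a| -
      pathDrop ⟨a, by omega⟩ i j x ^ 2 / ((j : ℝ) - i + 1) := by
    intro x; rw [pathEdgeGreen, pathGreen_self]; ring
  simp_rw [h, mul_sub, Finset.sum_sub_distrib, mul_div_assoc']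
  have h1 := sum_degree_mul_abs_sub (n := 2 * a) ⟨a, by omega⟩
  have h2 := sum_degree_mul_pathDrop_sq (v := ⟨a, by omega⟩) hij hG
  have h3 := sum_degree_mul_sup_edge hne (not_adj_pathGraph hij) hG
    fun y : Fin (2 * a + 1) => |(y : ℝ) - a|
  simp only at h1
  rw [← Finset.sum_div]
  rw [h3, h1, h2, momentGain]
  push_cast
  ring

open Classical in
-- Expand the quadratic form of the updated Green function at deg + e_i + e_j, deg being the degree
-- in the path. The cross terms are path hitting times of `i` and `j`, and the rank-one correction
-- gives the square of the weighted sum of `pathDrop`.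
theorem sum_degree_mul_sum_pathEdgeGreen {a : ℕ} {i j : Fin (2 * a + 1)}
    (hij : (i : ℕ) + 2 ≤ j)
    {G : SimpleGraph (Fin (2 * a + 1))} (hG : G = pathGraph (2 * a + 1) ⊔ edge i j) :
    ∑ y, (G.degree y : ℝ) *
      ∑ x, (G.degree x : ℝ) *
        pathEdgeGreen ⟨a, by omega⟩ i j x y = hittingSum a i j := by
  have hne : i ≠ j := by rw [Ne, Fin.ext_iff]; omega
  have hlt : (i : ℝ) < j := by exact_mod_cast (by omega : (i : ℕ) < j)
  have ha : 0 < a := by omega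
  set v : Fin (2 * a + 1) := ⟨a, by omega⟩ with hv
  have hsum := fun f => sum_degree_mul_sup_edge hne (not_adj_pathGraph hij) hG
    (f : Fin (2 * a + 1) → ℝ)
  have hhit : ∀ y, ∑ x, ((pathGraph (2 * a + 1)).degree x : ℝ) * pathGreen v x y =
      pathHitting a y := fun y => congrFun ((pathGraph_connected (2 * a)).isPotential_unique
    (isPotential_sum_degree_mul (isPotential_pathGreen (by omega) v))
    (isPotential_pathHitting ha)) y
  have hhit' : ∀ x, ∑ y, ((pathGraph (2 * a + 1)).degree y : ℝ) * pathGreen v x y =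
      pathHitting a x := by
    intro x
    rw [← hhit x]
    exact Finset.sum_congr rfl fun y _ => by rw [pathGreen_comm]
  have h1 : ∀ y, ∑ x, (G.degree x : ℝ) *
      pathEdgeGreen v i j x y = pathHitting a y + pathGreen v i y + pathGreen v j y -
      (∑ x, (G.degree x : ℝ) * pathDrop v i j x) *
        pathDrop v i j y / ((j : ℝ) - i + 1) := by
    intro y
    simp_rw [pathEdgeGreen, mul_sub, Finset.sum_sub_distrib]
    rw [hsum, hhit, Finset.sum_mul, Finset.sum_div]
    congr 1
    exact Finset.sum_congr rfl fun x _ => by ring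
  have h2 : ∀ y, (G.degree y : ℝ) *
      (∑ x, (G.degree x : ℝ) * pathEdgeGreen v i j x y) =
      (G.degree y : ℝ) *
        (pathHitting a y + pathGreen v i y + pathGreen v j y) -
      (∑ x, (G.degree x : ℝ) * pathDrop v i j x) /
        ((j : ℝ) - i + 1) *
        ((G.degree y : ℝ) * pathDrop v i j y) := by
    intro y; rw [h1]; ring
  rw [Finset.sum_congr rfl fun y _ => h2 y, Finset.sum_sub_distrib, ← Finset.mul_sum, hsum,
    sum_degree_mul_pathDrop hij hG]
  simp_rw [mul_add, Finset.sum_add_distrib]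
  rw [hhit', hhit', sum_degree_mul_pathHitting, pathGreen_self, pathGreen_self,
    pathGreen_comm v j i, pathGreen, abs_of_pos (by linarith : (0 : ℝ) < j - i), hittingSum,
    pathHitting, pathHitting]
  simp only [hv]
  push_cast
  ring

open Classical in
theorem card_edgeFinset_pathGraph (n : ℕ) :
    ((pathGraph (n + 1)).edgeFinset.card : ℝ) = n := by
  have := sum_degree_eq (pathGraph (n + 1))
  rw [sum_degree_pathGraph] at this
  linarith

open Classical in
theorem card_edgeFinset_pathGraph_sup_edge {n : ℕ} {i j : Fin (n + 1)} (hij : (i : ℕ) + 2 ≤ j)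
    {G : SimpleGraph (Fin (n + 1))} (hG : G = pathGraph (n + 1) ⊔ edge i j) :
    (G.edgeFinset.card : ℝ) = n + 1 := by
  have := sum_degree_eq G
  rw [sum_degree_sup_edge hij hG] at this
  linarith

/-! ### The inequality between the gain of the moment and that of the hitting time -/

/-- The new edge lies on one side of the center: `r` is the distance from the center to its nearer
end, `L` the distance between its ends in the path, `q` the distance from its farther end to the end
of the path. `M` is the gain of the moment and `B` the excess of the hitting sum over (4a + 2)(2a²/3
- 1/6). The multiplier gives (2a - r)(4a + 2)M < 3aB; with B < (4a + 2)M this yields (2a - r)B <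
3aB, that is (a + r)B > 0. -/
theorem braess_inequality_of_right {q L r a : ℝ} (hq : 0 ≤ q) (hr : 0 ≤ r) (hL : 2 ≤ L)
    (ha : a = q + L + r) {M B : ℝ}
    (hM : M * (L + 1) = (2 * r + L) * (L + 1) -
      (L * (2 * L ^ 2 + 1) / 3 + 2 * L ^ 2 * q + L ^ 2))
    (hB : B * (L + 1) = (2 * (2 * a * r - r ^ 2) + 2 * (2 * a * (r + L) - (r + L) ^ 2) +
      4 * r + L - 4 / 3 * a ^ 2 + 1 / 3) * (L + 1) - (L ^ 2 + 2 * L * q + L) ^ 2)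
    (h : B < (4 * a + 2) * M) : 0 < B := by
  have hL1 : 0 < L + 1 := by linarith
  have key : 0 < (3 * a * B - (2 * a - r) * ((4 * a + 2) * M)) * (L + 1) := by
    have e : (3 * a * B - (2 * a - r) * ((4 * a + 2) * M)) * (L + 1) =
        3 * a * (B * (L + 1)) - (2 * a - r) * (4 * a + 2) * (M * (L + 1)) := by ring
    rw [e, hM, hB, ha]
    -- In the variables `q`, `r` and `k = L - 2` the expanded polynomial has no negative
    -- coefficients.
    obtain ⟨k, hk, rfl⟩ : ∃ k, 0 ≤ k ∧ L = k + 2 := ⟨L - 2, by linarith, by ring⟩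
    ring_nf
    positivity
  have key2 := pos_of_mul_pos_left key hL1.le
  have h2 : (2 * a - r) * B ≤ (2 * a - r) * ((4 * a + 2) * M) :=
    mul_le_mul_of_nonneg_left h.le (by linarith)
  have h3 : 0 < (a + r) * B := by linarith
  exact pos_of_mul_pos_right h3 (by linarith)

/-- The center lies strictly between the ends of the edge, at distances `s` and `s + e`, and `q` is
the distance from the farther end to the nearest end of the path. The conclusion says that such an
edge never increases Kemeny's constant. -/
theorem braess_inequality_of_mid {q s e a : ℝ} (hq : 0 ≤ q) (hs : 1 ≤ s) (he : 0 ≤ e)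
    (ha : a = s + q + e) {M B : ℝ}
    (hM : M * (2 * s + e + 1) = (2 * s + e) * (2 * s + e + 1) -
      ((2 * s + e) * (2 * (2 * s + e) ^ 2 + 1) / 3 + 2 * (2 * s + e) ^ 2 * q + (2 * s + e) ^ 2 -
        2 * s * ((2 * s + e) ^ 2 + 2 * (2 * s + e) * q + (2 * s + e)) + (4 * a + 2) * s ^ 2))
    (hB : B * (2 * s + e + 1) = (2 * (2 * a * s - s ^ 2) + 2 * (2 * a * (s + e) - (s + e) ^ 2) +
      (2 * s + e) - 4 / 3 * a ^ 2 + 1 / 3) * (2 * s + e + 1) -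
      ((2 * s + e) ^ 2 + 2 * (2 * s + e) * q + (2 * s + e) - (4 * a + 2) * s) ^ 2) :
    (4 * a + 2) * M < B := by
  have hL1 : 0 < 2 * s + e + 1 := by linarith
  have key : 0 < (B - (4 * a + 2) * M) * (2 * s + e + 1) := by
    have e' : (B - (4 * a + 2) * M) * (2 * s + e + 1) =
        B * (2 * s + e + 1) - (4 * a + 2) * (M * (2 * s + e + 1)) := by ring
    rw [e', hM, hB, ha]
    obtain ⟨k, hk, rfl⟩ : ∃ k, 0 ≤ k ∧ s = k + 1 := ⟨s - 1, by linarith, by ring⟩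
    ring_nf
    positivity
  linarith [pos_of_mul_pos_left key hL1.le]

/-- If the edge `{i, j}` increases Kemeny's constant of the path, then it increases the mean
hitting time of the center from the stationary distribution. -/
theorem braess_inequality {a i j : ℕ} (hij : i + 2 ≤ j) (hj : j ≤ 2 * a)
    (h : hittingSum a i j - (4 * a + 2) * (2 / 3 * (a : ℝ) ^ 2 - 1 / 6) <
      (4 * a + 2) * momentGain a i j) :
    0 < hittingSum a i j - (4 * a + 2) * (2 / 3 * (a : ℝ) ^ 2 - 1 / 6) := by
  have hi0 : (0 : ℝ) ≤ i := Nat.cast_nonneg i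
  have hij' : (i : ℝ) + 2 ≤ j := by exact_mod_cast hij
  have hj' : (j : ℝ) ≤ 2 * a := by exact_mod_cast hj
  have hL : (j : ℝ) - i + 1 ≠ 0 := by linarith
  -- Both ends right of the center, both ends left (the mirror image), or the center strictly
  -- between them.
  rcases le_or_gt a i with h1 | h1
  · have h1' : (a : ℝ) ≤ i := by exact_mod_cast h1
    have hc : clampDist i j a = 0 := by
      rw [clampDist, abs_of_nonpos (by linarith), abs_of_nonpos (by linarith)]
      ring
    refine braess_inequality_of_right (q := 2 * a - j) (L := j - i) (r := i - a) (by linarith)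
      (by linarith) (by linarith) (by ring) ?_ ?_ h
    · rw [momentGain, hc, abs_of_nonneg (by linarith), abs_of_nonneg (by linarith)]
      field_simp
      ring
    · rw [hittingSum, hc, abs_of_nonneg (by linarith), abs_of_nonneg (by linarith)]
      field_simp
      ring
  rcases le_or_gt j a with h2 | h2
  · have h2' : (j : ℝ) ≤ a := by exact_mod_cast h2
    have hc : clampDist i j a = j - i := by
      rw [clampDist, abs_of_nonneg (by linarith), abs_of_nonneg (by linarith)]
      ring
    refine braess_inequality_of_right (q := i) (L := j - i) (r := a - j) (by linarith)
      (by linarith) (by linarith) (by ring) ?_ ?_ h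
    · rw [momentGain, hc, abs_of_nonpos (by linarith), abs_of_nonpos (by linarith)]
      field_simp
      ring
    · rw [hittingSum, hc, abs_of_nonpos (by linarith), abs_of_nonpos (by linarith)]
      field_simp
      ring
  have h1' : (i : ℝ) + 1 ≤ a := by exact_mod_cast h1
  have h2' : (a : ℝ) + 1 ≤ j := by exact_mod_cast h2
  have hc : clampDist i j a = a - i := by
    rw [clampDist, abs_of_nonneg (by linarith), abs_of_nonpos (by linarith)]
    ring
  -- An edge across the center contradicts the Braess hypothesis. The case split takes as `s` the
  -- smaller of the two distances to the center.
  refine absurd h (not_lt.mpr (le_of_lt ?_))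
  rcases le_total (a - i : ℝ) (j - a) with h3 | h3
  · refine braess_inequality_of_mid (q := 2 * a - j) (s := a - i) (e := j - a - (a - i))
      (by linarith) (by linarith) (by linarith) (by ring) ?_ ?_
    · rw [momentGain, hc, abs_of_nonpos (by linarith), abs_of_nonneg (by linarith)]
      field_simp
      ring
    · rw [hittingSum, hc, abs_of_nonpos (by linarith), abs_of_nonneg (by linarith)]
      field_simp
      ring
  · refine braess_inequality_of_mid (q := i) (s := j - a) (e := a - i - (j - a))
      (by linarith) (by linarith) (by linarith) (by ring) ?_ ?_
    · rw [momentGain, hc, abs_of_nonpos (by linarith), abs_of_nonneg (by linarith)]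
      field_simp
      ring
    · rw [hittingSum, hc, abs_of_nonpos (by linarith), abs_of_nonneg (by linarith)]
      field_simp
      ring

/-! ### Braess edges of the path and of the spider -/

theorem kemeny_pathGraph {a : ℕ} (ha : 0 < a) :
    (pathGraph (2 * a + 1)).kemeny = 2 * (a : ℝ) ^ 2 - (2 / 3 * (a : ℝ) ^ 2 - 1 / 6) := by
  classical
  have : Nontrivial (Fin (2 * a + 1)) := Fin.nontrivial_iff_two_le.mpr (by omega)
  have ha' : (a : ℝ) ≠ 0 := by exact_mod_cast ha.ne'
  rw [(pathGraph_connected (2 * a)).kemeny_eq (isPotential_pathHitting ha), moment_pathGraph ha,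
    sum_degree_mul_pathHitting, card_edgeFinset_pathGraph]
  push_cast
  field_simp
  ring

theorem kemeny_pathGraph_sup_edge {a : ℕ} {i j : Fin (2 * a + 1)} (hij : (i : ℕ) + 2 ≤ j) :
    (pathGraph (2 * a + 1) ⊔ edge i j).kemeny =
      2 * (a : ℝ) ^ 2 + momentGain a i j - hittingSum a i j / (4 * a + 2) := by
  classical
  have : Nontrivial (Fin (2 * a + 1)) := Fin.nontrivial_iff_two_le.mpr (by omega)
  rw [(connected_pathGraph_sup_edge i j).kemeny_eq
    (isPotential_sum_degree_mul (isPotential_pathEdgeGreen hij ⟨a, by omega⟩)),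
    moment_pathGraph_sup_edge hij rfl, sum_degree_mul_sum_pathEdgeGreen hij rfl,
    card_edgeFinset_pathGraph_sup_edge hij rfl]
  push_cast
  ring

/-- The first inequality is assertion 1, since moment minus Kemeny's constant is `hittingSum`
divided by the total degree 4a + 2. -/
theorem hittingSum_gt_of_kemeny_lt {a : ℕ} {i j : Fin (2 * a + 1)} (hij : (i : ℕ) + 2 ≤ j)
    (h : (pathGraph (2 * a + 1)).kemeny < (pathGraph (2 * a + 1) ⊔ edge i j).kemeny) :
    (2 / 3 * (a : ℝ) ^ 2 - 1 / 6) < hittingSum a i j / (4 * a + 2) ∧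
      hittingSum a i j / (4 * a + 2) - (2 / 3 * (a : ℝ) ^ 2 - 1 / 6) < momentGain a i j := by
  rw [kemeny_pathGraph (by omega), kemeny_pathGraph_sup_edge hij] at h
  have hD : (0 : ℝ) < 4 * a + 2 := by positivity
  have h2 : hittingSum a i j / (4 * a + 2) - (2 / 3 * (a : ℝ) ^ 2 - 1 / 6) < momentGain a i j := by
    linarith
  refine ⟨?_, h2⟩
  rw [lt_div_iff₀ hD]
  have := braess_inequality hij (Nat.lt_succ_iff.mp j.2) (by
    rw [← sub_pos] at h2 ⊢
    have := mul_pos hD h2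
    field_simp at this ⊢
    linarith)
  linarith

/-- Labels the legs off the chosen path. There may be none, in which case the second part of the
gluing is a single vertex. -/
theorem exists_embedding_compl_pair {b : ℕ} (c c' : Fin b) :
    ∃ (n : ℕ) (e : Fin n ↪ Fin b), ∀ l, l ∈ Set.range e ↔ l ≠ c ∧ l ≠ c' := by
  classical
  let f := (Fintype.equivFin {l : Fin b // l ≠ c ∧ l ≠ c'}).symm
  refine ⟨_, f.toEmbedding.trans (Function.Embedding.subtype _), fun l => ?_⟩
  constructor
  · rintro ⟨k, rfl⟩
    exact (f k).2
  · intro hl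
    exact ⟨f.symm ⟨l, hl⟩, by simp⟩

theorem isBraessEdge_spider {a b : ℕ} {i j : Fin (2 * a + 1)} (hij : (i : ℕ) + 2 ≤ j)
    {c c' : Fin b} (hc : c ≠ c') (h : (pathGraph (2 * a + 1)).IsBraessEdge i j) :
    (spider a b).IsBraessEdge (spiderPath c c' i) (spiderPath c c' j) := by
  classical
  have ha : 0 < a := by omega
  refine ⟨(spiderPath_injective hc).ne h.1,
    fun hadj => h.2.1 ((spider_adj_spiderPath hc i j).mp hadj), ?_⟩
  have : Nontrivial (Option (Fin b × Fin a)) := ⟨none, some (c, ⟨0, ha⟩), by simp⟩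
  obtain ⟨n, e, he⟩ := exists_embedding_compl_pair c c'
  have h0 := isOneSum_spider (a := a) hc e he
  have h1 := h0.sup_edge i j
  have k0 := h0.kemeny_eq (pathGraph_connected (2 * a)) (connected_spider a n)
    (isPotential_pathHitting ha) (isPotential_spider a n)
  have k1 := h1.kemeny_eq (connected_pathGraph_sup_edge i j) (connected_spider a n)
    (isPotential_sum_degree_mul (isPotential_pathEdgeGreen hij ⟨a, by omega⟩))
    (isPotential_spider a n)
  change _ < (spider a b ⊔ edge (spiderPathEmb hc i) (spiderPathEmb hc j)).kemeny
  rw [k0, k1, moment_pathGraph ha, moment_pathGraph_sup_edge hij rfl, sum_degree_mul_pathHitting,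
    sum_degree_mul_spider, sum_degree_mul_sum_pathEdgeGreen hij rfl, card_edgeFinset_pathGraph,
    card_edgeFinset_pathGraph_sup_edge hij rfl, card_edgeFinset_spider ha]
  obtain ⟨g1, g2⟩ := hittingSum_gt_of_kemeny_lt hij h.2.2
  -- Here `κ` is the mean hitting time of the center before the edge is added, not Kemeny's
  -- constant.
  set κ : ℝ := 2 / 3 * (a : ℝ) ^ 2 - 1 / 6
  set C := hittingSum a i j
  have ha' : (0 : ℝ) < a := by exact_mod_cast ha
  have hn : (0 : ℝ) ≤ (n : ℝ) * a := by positivity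
  have hD : (0 : ℝ) < 4 * a + 2 := by positivity
  rw [lt_div_iff₀ hD] at g1
  have e0 : (4 * a * κ + n * (2 * a * κ)) / (2 * (((2 * a : ℕ) : ℝ) + n * a)) = κ := by
    rw [div_eq_iff (by push_cast; positivity)]
    push_cast
    ring
  have e1 : (C + n * (2 * a * κ)) / (2 * (((2 * a : ℕ) : ℝ) + 1 + n * a)) - κ =
      (C - κ * (4 * a + 2)) / (4 * a + 2 + 2 * (n * a)) := by
    have h1 : (2 * (((2 * a : ℕ) : ℝ) + 1 + n * a)) = 4 * a + 2 + 2 * (n * a) := by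
      push_cast; ring
    rw [h1]
    field_simp
    ring
  -- The excess of the hitting sum is positive by `g1`, so spreading it over the extra degree of the
  -- other legs can only lower the loss.
  have e2 : (C - κ * (4 * a + 2)) / (4 * a + 2 + 2 * (n * a)) ≤ C / (4 * a + 2) - κ := by
    have h1 : C / (4 * a + 2) - κ = (C - κ * (4 * a + 2)) / (4 * a + 2) := by
      field_simp
    rw [h1]
    exact div_le_div_of_nonneg_left (by linarith) hD (by linarith)
  rw [e0]
  linarith

end SimpleGraph

theorem lemma4p6 (a : ℕ) (ha : 2 ≤ a) (i j : Fin (2 * a + 1)) (hij : (i : ℕ) + 2 ≤ (j : ℕ)) :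
    (0 < (SimpleGraph.pathGraph (2 * a + 1) ⊔ SimpleGraph.edge i j).kemeny
          - (SimpleGraph.pathGraph (2 * a + 1)).kemeny →
      0 < (SimpleGraph.pathGraph (2 * a + 1) ⊔ SimpleGraph.edge i j).moment ⟨a, by omega⟩
          - (SimpleGraph.pathGraph (2 * a + 1) ⊔ SimpleGraph.edge i j).kemeny
          - 2 / 3 * (a : ℝ) ^ 2 + 1 / 6) ∧
    ((SimpleGraph.pathGraph (2 * a + 1)).IsBraessEdge i j →
      ∀ (b : ℕ), 2 ≤ b → ∀ c c' : Fin b, c ≠ c' →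
        (SimpleGraph.spider a b).IsBraessEdge
          (SimpleGraph.spiderPath c c' i) (SimpleGraph.spiderPath c c' j)) := by
  refine ⟨fun h => ?_, fun h b _ c c' hc => SimpleGraph.isBraessEdge_spider hij hc h⟩
  have := (SimpleGraph.hittingSum_gt_of_kemeny_lt hij (sub_pos.mp h)).1
  rw [SimpleGraph.moment_pathGraph_sup_edge hij rfl, SimpleGraph.kemeny_pathGraph_sup_edge hij]
  linarith
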